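/- Conventions. Let $n\ge 1$. Functions are measurable, with real or complex values, and a weight on $\mathbb R^n$ is an almost everywhere positive, locally integrable function. For a weight $w$ put $$\|w\|_{A_r}=\sup_Q\Big(\frac1{|Q|}\int_Q w\Big)\Big(\frac1{|Q|}\int_Q w^{-1/(r-1)}\Big)^{r-1}\quad(1<r<\infty),\qquad \|w\|_{A_1}=\sup_Q\Big(\frac1{|Q|}\int_Q w\Big)\,\operatorname*{ess\,sup}_Q w^{-1},$$ where $Q$ runs over all cubes in $\mathbb R^n$ with sides parallel to the axes, and write $w\in A_r$ if $\|w\|_{A_r}<\infty$. For $0<r<\infty$ put $\|g\|_{L^{r,\infty}(w)}=\sup_{y>0}y\,w(\{x:|g(x)|>y\})^{1/r}$. A function $\varphi:(0,\infty)^2\to[0,\infty)$ is called locally bounded if $\sup_{0<s,t<M}\varphi(s,t)<\infty$ for every $M>0$. Theorem 3.11. Let $p_1,p_2\ge 1$, $\frac1p=\frac1{p_1}+\frac1{p_2}$, and let $T$ be an operator (not necessarily linear in either variable) assigning to pairs $(f_1,f_2)$ of functions on $\mathbb R^n$ a function $T(f_1,f_2)$ on $\mathbb R^n$. Suppose that there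 is a locally bounded function $\varphi$ such that $$T:L^{p_1}(w_1)\times L^{p_2}(w_2)\longrightarrow L^{p,\infty}(w),\qquad w=w_1^{p/p_1}w_2^{p/p_2},$$ is bounded for all $w_1\in A_{p_1}$ and $w_2\in A_{p_2}$ with constant $\varphi(\|w_1\|_{A_{p_1}},\|w_2\|_{A_{p_2}})$, that is, $$\|T(f_1,f_2)\|_{L^{p,\infty}(w)}\le\varphi(\|w_1\|_{A_{p_1}},\|w_2\|_{A_{p_2}})\,\|f_1\|_{L^{p_1}(w_1)}\|f_2\|_{L^{p_2}(w_2)}\quad\text{for all }f_j\in L^{p_j}(w_j).$$ Then for all $q_1,q_2>1$, with $\frac1q=\frac1{q_1}+\frac1{q_2}$, there is a locally bounded function $\psi$ such that for all $w_1\in A_{q_1}$ and $w_2\in A_{q_2}$ $$T:L^{q_1}(w_1)\times L^{q_2}(w_2)\longrightarrow L^{q,\infty}(w),\qquad w=w_1^{q/q_1}w_2^{q/q_2},$$ is bounded with constant $\psi(\|w_1\|_{A_{q_1}},\|w_2\|_{A_{q_2}})$. -/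

import Mathlib

open MeasureTheory
open scoped ENNReal NNReal

noncomputable section

/-- The closed cube in `ℝⁿ` with centre `c`, side length `2 * r` and sides parallel to the axes. -/
def cube {n : ℕ} (c : Fin n → ℝ) (r : ℝ) : Set (Fin n → ℝ) :=
  Set.Icc (fun i => c i - r) (fun i => c i + r)

/-- A weight on `ℝⁿ`: a measurable function with values in `[0, ∞]`, positive almost everywhere and
locally integrable (hence finite almost everywhere). -/
structure IsWeight {n : ℕ} (w : (Fin n → ℝ) → ℝ≥0∞) : Prop where
  aemeasurable : AEMeasurable w volume
  pos : ∀ᵐ x, 0 < w x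
  locallyIntegrable : ∀ (c : Fin n → ℝ) (r : ℝ), 0 < r → ∫⁻ x in cube c r, w x < ∞

/-- The Muckenhoupt constant `‖w‖_{A_p}`, `1 ≤ p < ∞`, the suprema being over all cubes `Q`:
`sup_Q (⨍_Q w) (⨍_Q w^{-1/(p-1)})^{p-1}` if `p > 1`, and
`sup_Q (⨍_Q w) (ess sup_Q w⁻¹)` if `p = 1`. -/
def apConst {n : ℕ} (p : ℝ) (w : (Fin n → ℝ) → ℝ≥0∞) : ℝ≥0∞ :=
  if p = 1 then
    ⨆ (c : Fin n → ℝ) (r : ℝ) (_ : 0 < r),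
      (⨍⁻ x in cube c r, w x ∂volume) * essSup (fun x => (w x)⁻¹) (volume.restrict (cube c r))
  else
    ⨆ (c : Fin n → ℝ) (r : ℝ) (_ : 0 < r),
      (⨍⁻ x in cube c r, w x ∂volume) * (⨍⁻ x in cube c r, w x ^ (-1 / (p - 1)) ∂volume) ^ (p - 1)

/-- The Muckenhoupt class `A_p`. -/
def MemAp {n : ℕ} (p : ℝ) (w : (Fin n → ℝ) → ℝ≥0∞) : Prop :=
  IsWeight w ∧ apConst p w < ∞

/-- The quasi-norm of `g` in the weak Lebesgue space `L^{p,∞}(μ)`: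
`sup_{y > 0} y μ({|g| > y})^{1/p}`. -/
def weakLpNorm {α E : Type*} [MeasurableSpace α] [NormedAddCommGroup E]
    (g : α → E) (p : ℝ) (μ : Measure α) : ℝ≥0∞ :=
  ⨆ y : ℝ≥0, (y : ℝ≥0∞) * μ {x | (y : ℝ) < ‖g x‖} ^ (1 / p)

/-- `T : L^{p₁}(w₁) × L^{p₂}(w₂) → L^{p,∞}(w)` is bounded with constant `C`: for all
`f₁ ∈ L^{p₁}(w₁)` and `f₂ ∈ L^{p₂}(w₂)` the function `T(f₁, f₂)` is measurable and
`‖T(f₁, f₂)‖_{L^{p,∞}(w)} ≤ C ‖f₁‖_{L^{p₁}(w₁)} ‖f₂‖_{L^{p₂}(w₂)}`. -/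
def WeakBoundedWith {n : ℕ} {𝕜 : Type*} [RCLike 𝕜]
    (T : ((Fin n → ℝ) → 𝕜) → ((Fin n → ℝ) → 𝕜) → ((Fin n → ℝ) → 𝕜))
    (p₁ p₂ p : ℝ) (w₁ w₂ w : (Fin n → ℝ) → ℝ≥0∞) (C : ℝ≥0) : Prop :=
  ∀ f₁ f₂ : (Fin n → ℝ) → 𝕜,
    MemLp f₁ (ENNReal.ofReal p₁) (volume.withDensity w₁) →
    MemLp f₂ (ENNReal.ofReal p₂) (volume.withDensity w₂) →
    AEStronglyMeasurable (T f₁ f₂) (volume.withDensity w) ∧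
    weakLpNorm (T f₁ f₂) p (volume.withDensity w) ≤
      C * eLpNorm f₁ (ENNReal.ofReal p₁) (volume.withDensity w₁) *
        eLpNorm f₂ (ENNReal.ofReal p₂) (volume.withDensity w₂)

/-- `φ : (0, ∞)² → [0, ∞)` is locally bounded: `sup_{0 < s, t < M} φ(s, t) < ∞` for all `M`. -/
def LocallyBdd (φ : ℝ≥0 → ℝ≥0 → ℝ≥0) : Prop :=
  ∀ M : ℝ≥0, ∃ C : ℝ≥0, ∀ s t : ℝ≥0, 0 < s → s < M → 0 < t → t < M → φ s t ≤ C

end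

/-! The variables are treated one at a time. Freeze `f₂` and `w₂ ∈ A_r`, and put `H = y · 1_E ·
w₂^{1/r}` with `E = {|T(f₁, f₂)| > y}`. For `w = u^{p/p₀} w₂^{p/r}` the number `y w(E)^{1/p}` is the
norm of `H` in `L^p(u^{p/p₀})`. The weak bound thus becomes a strong inequality between two fixed
functions `H` and `f₁`, valid for every `u ∈ A_{p₀}`; no linearity of `T` enters. The difference
`1/p - 1/p₀ = 1/r` stays constant, and off-diagonal extrapolation (`extrapolatesTo`) moves `(p₀, p)`
to `(q₀, q)`. Exchanging the variables and repeating gives the theorem.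

The scalar extrapolation rests on Rubio de Francia's algorithm: where the maximal operator `M` is
bounded, a function has a majorant `F` of comparable norm with `M F ≤ c F`. If `q₀ < p₀`, `F`
majorizes `f`, the weight is `w F^{q₀-p₀}`, and Hölder's inequality returns to `w`. If `q₀ > p₀`,
the algorithm runs in the dual space on a function built from the left-hand integrand, and the
weight is `F^θ w^{1-θ}` with `θ = (q₀-p₀)/(q₀-1)`.

Every constant may depend on a weight only through a bound for its Muckenhoupt constant. For `M`
this is `exists_weighted_hlMax_bound`, by Lerner's argument: `M` is dominated by a composition of
centred maximal operators for the measures `w dx` and `w^{-1/(q-1)} dx`, and Besicovitch's covering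
theorem bounds these independently of the measure. -/

section MaximalFunction

/-! ### Centred maximal operators for arbitrary measures -/

variable {E : Type*} [MetricSpace E] [MeasurableSpace E]

/-- The centred maximal function of the measure `ν` with respect to the measure `μ`. -/
noncomputable def maxFun (μ ν : Measure E) (x : E) : ℝ≥0∞ :=
  ⨆ r : {r : ℚ // 0 < r}, ν (Metric.closedBall x (r : ℚ)) / μ (Metric.closedBall x (r : ℚ))

lemma le_maxFun (μ ν : Measure E) (x : E) {r : ℚ} (hr : 0 < r) :
    ν (Metric.closedBall x r) / μ (Metric.closedBall x r) ≤ maxFun μ ν x :=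
  le_iSup (fun r : {r : ℚ // 0 < r} =>
    ν (Metric.closedBall x (r : ℚ)) / μ (Metric.closedBall x (r : ℚ))) ⟨r, hr⟩

lemma measurable_measure_closedBall [SecondCountableTopology E] [BorelSpace E]
    (μ : Measure E) [SFinite μ] (r : ℝ) : Measurable fun x => μ (Metric.closedBall x r) := by
  have hs : MeasurableSet {p : E × E | dist p.2 p.1 ≤ r} :=
    (isClosed_le (by fun_prop) continuous_const).measurableSet
  exact measurable_measure_prodMk_left hs

lemma measurable_maxFun [SecondCountableTopology E] [BorelSpace E]
    (μ ν : Measure E) [SFinite μ] [SFinite ν] : Measurable (maxFun μ ν) :=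
  Measurable.iSup fun _ => (measurable_measure_closedBall ν _).div (measurable_measure_closedBall μ _)

/-- The constant of the Besicovitch covering theorem gives a weak type `(1, 1)` bound. -/
lemma exists_weak_type_maxFun (E : Type*) [MetricSpace E] [MeasurableSpace E]
    [SecondCountableTopology E] [BorelSpace E] [HasBesicovitchCovering E] :
    ∃ N : ℕ, ∀ (μ ν : Measure E) (a : ℝ≥0∞),
      a * μ {x | a < maxFun μ ν x} ≤ N * ν Set.univ := by
  obtain ⟨N, τ, hτ, hN⟩ := HasBesicovitchCovering.no_satelliteConfig (α := E)
  refine ⟨N, fun μ ν a => ?_⟩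
  -- The covering theorem needs bounded radii; the bound `k` is removed by monotone convergence.
  let A : ℕ → Set E := fun k => {x | ∃ r : ℚ, 0 < r ∧ r ≤ k ∧
    a < ν (Metric.closedBall x r) / μ (Metric.closedBall x r)}
  have hA : {x | a < maxFun μ ν x} = ⋃ k, A k := by
    ext x
    simp only [maxFun, Set.mem_ofPred_eq, lt_iSup_iff, Set.mem_iUnion, A]
    constructor
    · rintro ⟨⟨r, hr⟩, h⟩
      obtain ⟨k, hk⟩ := exists_nat_ge r
      exact ⟨k, r, hr, hk, h⟩
    · rintro ⟨k, r, hr, hk, h⟩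
      exact ⟨⟨r, hr⟩, h⟩
  have hmono : Monotone A := fun k l hkl x ⟨r, hr, hk, h⟩ =>
    ⟨r, hr, hk.trans (by exact_mod_cast hkl), h⟩
  rw [hA, hmono.measure_iUnion, ENNReal.mul_iSup]
  refine iSup_le fun k => ?_
  choose r hr hrk hra using fun x : A k => x.2
  let q : Besicovitch.BallPackage (A k) E :=
    { c := fun x => x, r := fun x => r x, rpos := fun x => by exact_mod_cast hr x
      r_bound := k, r_le := fun x => by exact_mod_cast hrk x }
  obtain ⟨s, hs, hcov⟩ := Besicovitch.exist_disjoint_covering_families hτ hN q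
  have hcount : ∀ i, (s i).Countable := fun i =>
    (hs i).countable_of_nonempty_interior fun x _ =>
      ⟨x, Metric.ball_subset_interior_closedBall (Metric.mem_ball_self (q.rpos x))⟩
  have hle : ∀ x : A k, a * μ (Metric.closedBall (q.c x) (q.r x)) ≤
      ν (Metric.closedBall (q.c x) (q.r x)) := fun x =>
    ENNReal.mul_le_of_le_div (hra x).le
  have hi : ∀ i, a * μ (⋃ x ∈ s i, Metric.ball (q.c x) (q.r x)) ≤ ν Set.univ := by
    intro i
    have := (hcount i).to_subtype
    calc a * μ (⋃ x ∈ s i, Metric.ball (q.c x) (q.r x))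
        ≤ a * ∑' x : s i, μ (Metric.closedBall (q.c x) (q.r x)) := by
          gcongr
          refine (measure_biUnion_le μ (hcount i) _).trans ?_
          exact ENNReal.tsum_le_tsum fun x => measure_mono Metric.ball_subset_closedBall
      _ = ∑' x : s i, a * μ (Metric.closedBall (q.c x) (q.r x)) := ENNReal.tsum_mul_left.symm
      _ ≤ ∑' x : s i, ν (Metric.closedBall (q.c x) (q.r x)) :=
          ENNReal.tsum_le_tsum fun x => hle x
      _ = ν (⋃ x ∈ s i, Metric.closedBall (q.c x) (q.r x)) :=
          (measure_biUnion (hcount i) (hs i) fun x _ => Metric.isClosed_closedBall.measurableSet).symm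
      _ ≤ ν Set.univ := measure_mono (Set.subset_univ _)
  calc a * μ (A k) ≤ a * ∑ i : Fin N, μ (⋃ x ∈ s i, Metric.ball (q.c x) (q.r x)) := by
        gcongr
        refine (measure_mono ?_).trans (measure_iUnion_fintype_le μ _)
        intro x hx
        exact hcov ⟨⟨x, hx⟩, rfl⟩
    _ = ∑ i : Fin N, a * μ (⋃ x ∈ s i, Metric.ball (q.c x) (q.r x)) := Finset.mul_sum _ _ _
    _ ≤ ∑ i : Fin N, ν Set.univ := Finset.sum_le_sum fun i _ => hi i
    _ = N * ν Set.univ := by simp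

/-- Layer cake inequality for functions with values in `[0, ∞]`. -/
lemma lintegral_rpow_le_lintegral_meas_lt {α : Type*} [MeasurableSpace α] (μ : Measure α)
    {F : α → ℝ≥0∞} (hF : AEMeasurable F μ) {p : ℝ} (hp : 0 < p) :
    ∫⁻ x, F x ^ p ∂μ ≤ ENNReal.ofReal p *
      ∫⁻ t in Set.Ioi (0 : ℝ), μ {x | ENNReal.ofReal t < F x} * ENNReal.ofReal (t ^ (p - 1)) := by
  -- Truncation at `k` gives access to the layer cake formula for real-valued functions.
  have h1 : ∀ x, F x ^ p = ⨆ k : ℕ, (min (F x) k) ^ p := by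
    intro x
    have hm : Monotone fun k : ℕ => min (F x) (k : ℝ≥0∞) := fun k l h =>
      min_le_min le_rfl (by exact_mod_cast h)
    have : F x = ⨆ k : ℕ, min (F x) k := by
      rw [← inf_iSup_eq, ENNReal.iSup_natCast, inf_top_eq]
    conv_lhs => rw [this]
    exact (ENNReal.orderIsoRpow p hp).map_iSup _
  simp_rw [h1]
  rw [lintegral_iSup' (fun k => (hF.min aemeasurable_const).pow_const p)
    (Filter.Eventually.of_forall fun x k l h => by dsimp only; gcongr)]
  refine iSup_le fun k => ?_
  have hne : ∀ x, min (F x) (k : ℝ≥0∞) ≠ ∞ := fun x =>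
    ((min_le_right _ _).trans_lt (ENNReal.natCast_lt_top k)).ne
  calc ∫⁻ x, min (F x) k ^ p ∂μ
      = ∫⁻ x, ENNReal.ofReal ((min (F x) k).toReal ^ p) ∂μ := by
        refine lintegral_congr fun x => ?_
        rw [← ENNReal.ofReal_rpow_of_nonneg ENNReal.toReal_nonneg hp.le,
          ENNReal.ofReal_toReal (hne x)]
    _ = ENNReal.ofReal p * ∫⁻ t in Set.Ioi (0 : ℝ),
          μ {x | t < (min (F x) k).toReal} * ENNReal.ofReal (t ^ (p - 1)) :=
        lintegral_rpow_eq_lintegral_meas_lt_mul μ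
          (Filter.Eventually.of_forall fun x => ENNReal.toReal_nonneg)
          (hF.min aemeasurable_const).ennreal_toReal hp
    _ ≤ _ := by
        gcongr ENNReal.ofReal p * ?_
        refine setLIntegral_mono' measurableSet_Ioi fun t ht => ?_
        gcongr ?_ * _
        refine measure_mono fun x hx => ?_
        exact ((ENNReal.ofReal_lt_iff_lt_toReal (le_of_lt ht) (hne x)).2 hx).trans_le
          (min_le_left _ _)

/-- Truncation at height `t / 2` in the weak type bound. -/
lemma meas_lt_maxFun_le {E : Type*} [MetricSpace E] [MeasurableSpace E]
    [SecondCountableTopology E] [BorelSpace E] {N : ℕ}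
    (hN : ∀ (μ ν : Measure E) (a : ℝ≥0∞), a * μ {x | a < maxFun μ ν x} ≤ N * ν Set.univ)
    (μ : Measure E) [SFinite μ] {f : E → ℝ≥0∞} (hf : ∀ᵐ x ∂μ, f x ≠ ∞) {t : ℝ} (ht : 0 < t) :
    μ {x | ENNReal.ofReal t < maxFun μ (μ.withDensity f) x} ≤
      N * (ENNReal.ofReal (t / 2))⁻¹ * μ.withDensity f {x | t < 2 * (f x).toReal} := by
  set S : Set E := {x | t < 2 * (f x).toReal} with hS
  set a : ℝ≥0∞ := ENNReal.ofReal (t / 2) with ha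
  have ha0 : a ≠ 0 := by simpa [ha] using ht
  have hat : a ≠ ∞ := ENNReal.ofReal_ne_top
  have haa : ENNReal.ofReal t = a + a := by
    rw [ha, ← ENNReal.ofReal_add (by linarith) (by linarith), add_halves]
  have hle : ∀ᵐ x ∂μ, f x ≤ S.indicator f x + a := by
    filter_upwards [hf] with x hx
    by_cases hxS : x ∈ S
    · simp [hxS]
    · have : (f x).toReal ≤ t / 2 := by
        have : ¬ t < 2 * (f x).toReal := hxS
        linarith
      simpa [hxS] using (ENNReal.le_ofReal_iff_toReal_le hx (by linarith)).2 this
  have hsub : {x | ENNReal.ofReal t < maxFun μ (μ.withDensity f) x} ⊆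
      {x | a < maxFun μ (μ.withDensity (S.indicator f)) x} := by
    intro x hx
    by_contra hcon
    simp only [Set.mem_ofPred_eq, not_lt] at hx hcon
    refine absurd hx (not_lt.2 ?_)
    refine iSup_le fun r => ?_
    have h1 : μ.withDensity f (Metric.closedBall x (r : ℚ)) ≤
        μ.withDensity (S.indicator f) (Metric.closedBall x (r : ℚ)) +
          a * μ (Metric.closedBall x (r : ℚ)) := by
      rw [withDensity_apply' f, withDensity_apply' (S.indicator f)]
      refine (lintegral_mono_ae (ae_restrict_of_ae hle)).trans ?_
      rw [lintegral_add_right _ measurable_const, setLIntegral_const]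
    calc μ.withDensity f (Metric.closedBall x (r : ℚ)) / μ (Metric.closedBall x (r : ℚ))
        ≤ (μ.withDensity (S.indicator f) (Metric.closedBall x (r : ℚ)) +
          a * μ (Metric.closedBall x (r : ℚ))) / μ (Metric.closedBall x (r : ℚ)) := by gcongr
      _ = μ.withDensity (S.indicator f) (Metric.closedBall x (r : ℚ)) /
            μ (Metric.closedBall x (r : ℚ)) +
          a * μ (Metric.closedBall x (r : ℚ)) / μ (Metric.closedBall x (r : ℚ)) :=
          ENNReal.add_div
      _ ≤ a + a := by
          refine add_le_add ((le_maxFun _ _ x r.2).trans hcon) ?_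
          rw [mul_div_assoc]
          exact mul_le_of_le_one_right' ENNReal.div_self_le_one
      _ = ENNReal.ofReal t := haa.symm
  refine (measure_mono hsub).trans ?_
  have h2 := hN μ (μ.withDensity (S.indicator f)) a
  have h3 : μ.withDensity (S.indicator f) Set.univ ≤ μ.withDensity f S := by
    rw [withDensity_apply' f, withDensity_apply' (S.indicator f), Measure.restrict_univ]
    exact lintegral_indicator_le _ _
  calc μ {x | a < maxFun μ (μ.withDensity (S.indicator f)) x}
      = a⁻¹ * (a * μ {x | a < maxFun μ (μ.withDensity (S.indicator f)) x}) := by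
        rw [← mul_assoc, ENNReal.inv_mul_cancel ha0 hat, one_mul]
    _ ≤ a⁻¹ * (N * μ.withDensity f S) := by
        gcongr a⁻¹ * ?_
        exact h2.trans (by gcongr)
    _ = _ := by ring

/-- Strong type bound for the maximal operator with respect to an arbitrary measure. -/
lemma exists_strong_type_maxFun (E : Type*) [MetricSpace E] [MeasurableSpace E]
    [SecondCountableTopology E] [BorelSpace E] [HasBesicovitchCovering E] {p : ℝ} (hp : 1 < p) :
    ∃ C : ℝ≥0, ∀ (μ : Measure E) [SFinite μ] (f : E → ℝ≥0∞), AEMeasurable f μ →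
      ∫⁻ x, maxFun μ (μ.withDensity f) x ^ p ∂μ ≤ C * ∫⁻ x, f x ^ p ∂μ := by
  obtain ⟨N, hN⟩ := exists_weak_type_maxFun E
  -- The summand `1` keeps the constant nonzero, so that the bound is trivial when the right-hand
  -- integral is infinite.
  refine ⟨p.toNNReal * (2 * N) * ((p - 1).toNNReal⁻¹ * 2 ^ (p - 1)) + 1, fun μ _ f hf => ?_⟩
  by_cases hfin : ∫⁻ x, f x ^ p ∂μ = ∞
  · rw [hfin, ENNReal.mul_top (by simp)]
    exact le_top
  have hftop : ∀ᵐ x ∂μ, f x ≠ ∞ := by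
    filter_upwards [ae_lt_top' (hf.pow_const p) hfin] with x hx h
    rw [h, ENNReal.top_rpow_of_pos (by linarith)] at hx
    exact lt_irrefl _ hx
  have hp1 : 0 < p - 1 := by linarith
  set ν := μ.withDensity f with hν
  have hνμ : ν ≪ μ := withDensity_absolutelyContinuous μ f
  -- Layer cake for `ν` with exponent `p - 1`; the missing power of `f` is the density of `ν`.
  have key : ENNReal.ofReal (p - 1) * ∫⁻ t in Set.Ioi (0 : ℝ),
      ν {x | t < 2 * (f x).toReal} * ENNReal.ofReal (t ^ (p - 1 - 1)) =
        2 ^ (p - 1) * ∫⁻ x, f x ^ p ∂μ := by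
    rw [← lintegral_rpow_eq_lintegral_meas_lt_mul ν
      (f := fun x => 2 * (f x).toReal) (Filter.Eventually.of_forall fun x => by positivity)
      ((hf.mono_ac hνμ).ennreal_toReal.const_mul 2) hp1]
    rw [hν, lintegral_withDensity_eq_lintegral_mul₀ hf
      ((((hf.ennreal_toReal.const_mul 2).pow_const _)).ennreal_ofReal),
      ← lintegral_const_mul'' _ (hf.pow_const p)]
    refine lintegral_congr_ae ?_
    filter_upwards [hftop] with x hx
    rw [Pi.mul_apply, ← ENNReal.ofReal_rpow_of_nonneg (by positivity) hp1.le,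
      ENNReal.ofReal_mul (by norm_num), ENNReal.ofReal_toReal hx,
      ENNReal.mul_rpow_of_nonneg _ _ hp1.le, ENNReal.ofReal_ofNat]
    have : f x ^ p = f x * f x ^ (p - 1) := by
      conv_lhs => rw [show p = 1 + (p - 1) by ring,
        ENNReal.rpow_add_of_nonneg _ _ zero_le_one hp1.le, ENNReal.rpow_one]
    rw [this]
    ring
  have hpow : ENNReal.ofReal p * ∫⁻ t in Set.Ioi (0 : ℝ),
      μ {x | ENNReal.ofReal t < maxFun μ ν x} * ENNReal.ofReal (t ^ (p - 1)) ≤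
      ENNReal.ofReal p * (2 * N) * ∫⁻ t in Set.Ioi (0 : ℝ),
        ν {x | t < 2 * (f x).toReal} * ENNReal.ofReal (t ^ (p - 1 - 1)) := by
    rw [mul_assoc, ← lintegral_const_mul' (2 * (N : ℝ≥0∞)) _
      (ENNReal.mul_ne_top (by simp) (by simp))]
    gcongr ENNReal.ofReal p * ?_
    refine setLIntegral_mono' measurableSet_Ioi fun t ht => ?_
    have ht : 0 < t := ht
    refine (mul_le_mul_left (meas_lt_maxFun_le hN μ hftop ht) _).trans (le_of_eq ?_)
    have e1 : (ENNReal.ofReal (t / 2))⁻¹ = ENNReal.ofReal (2 / t) := by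
      rw [← ENNReal.ofReal_inv_of_pos (by positivity), inv_div]
    have e2 : ENNReal.ofReal (2 / t) * ENNReal.ofReal (t ^ (p - 1)) =
        2 * ENNReal.ofReal (t ^ (p - 1 - 1)) := by
      rw [← ENNReal.ofReal_mul (by positivity), Real.rpow_sub_one ht.ne' (p - 1),
        ← ENNReal.ofReal_ofNat 2, ← ENNReal.ofReal_mul (by norm_num)]
      congr 1
      ring
    rw [e1, ← hν]
    calc _ = N * ν {x | t < 2 * (f x).toReal} *
          (ENNReal.ofReal (2 / t) * ENNReal.ofReal (t ^ (p - 1))) := by ring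
      _ = _ := by rw [e2]; ring
  refine (lintegral_rpow_le_lintegral_meas_lt μ (measurable_maxFun μ ν).aemeasurable
    (by linarith)).trans (hpow.trans ?_)
  have hpn : ENNReal.ofReal (p - 1) ≠ 0 := by simpa using hp1
  have key2 : ∫⁻ t in Set.Ioi (0 : ℝ),
      ν {x | t < 2 * (f x).toReal} * ENNReal.ofReal (t ^ (p - 1 - 1)) =
        (ENNReal.ofReal (p - 1))⁻¹ * (2 ^ (p - 1) * ∫⁻ x, f x ^ p ∂μ) := by
    rw [← key, ← mul_assoc, ENNReal.inv_mul_cancel hpn ENNReal.ofReal_ne_top, one_mul]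
  rw [key2]
  have hC : (((p.toNNReal * (2 * N) * ((p - 1).toNNReal⁻¹ * 2 ^ (p - 1)) : ℝ≥0)) : ℝ≥0∞) =
      ENNReal.ofReal p * (2 * N) * ((ENNReal.ofReal (p - 1))⁻¹ * 2 ^ (p - 1)) := by
    rw [ENNReal.coe_mul, ENNReal.coe_mul, ENNReal.coe_mul, ENNReal.coe_mul,
      ENNReal.coe_inv (by simpa using hp1), ENNReal.coe_rpow_of_nonneg _ hp1.le]
    simp [ENNReal.ofReal]
  rw [ENNReal.coe_add, hC, add_mul]
  refine le_add_right (le_of_eq ?_)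
  ring

end MaximalFunction

/-! ### Muckenhoupt's theorem by Lerner's argument -/

lemma cube_eq_closedBall {n : ℕ} (c : Fin n → ℝ) {r : ℝ} (hr : 0 ≤ r) :
    cube c r = Metric.closedBall c r := by
  ext x
  simp only [cube, Metric.mem_closedBall, dist_pi_le_iff hr, Set.mem_Icc, Pi.le_def,
    Real.dist_eq, abs_le]
  constructor
  · rintro ⟨h1, h2⟩ i
    constructor <;> linarith [h1 i, h2 i]
  · intro h
    constructor <;> intro i <;> linarith [(h i).1, (h i).2]

lemma volume_closedBall_three_mul {n : ℕ} (c : Fin n → ℝ) {r : ℝ} (hr : 0 ≤ r) :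
    volume (Metric.closedBall c (3 * r)) = 3 ^ n * volume (Metric.closedBall c r) := by
  rw [Real.volume_pi_closedBall _ hr, Real.volume_pi_closedBall _ (by positivity),
    Fintype.card_fin, show 2 * (3 * r) = 3 * (2 * r) by ring, mul_pow,
    ENNReal.ofReal_mul (by positivity)]
  simp

lemma volume_closedBall_pos {n : ℕ} (c : Fin n → ℝ) {r : ℝ} (hr : 0 < r) :
    volume (Metric.closedBall c r) ≠ 0 := (Metric.measure_closedBall_pos volume c hr).ne'

lemma volume_closedBall_lt_top {n : ℕ} (c : Fin n → ℝ) (r : ℝ) :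
    volume (Metric.closedBall c r) ≠ ∞ := measure_closedBall_lt_top.ne

/-- The centred Hardy–Littlewood maximal function. -/
noncomputable def hlMax {n : ℕ} (f : (Fin n → ℝ) → ℝ≥0∞) : (Fin n → ℝ) → ℝ≥0∞ :=
  maxFun volume (volume.withDensity f)

lemma withDensity_eq_withDensity_withDensity {α : Type*} [MeasurableSpace α] {μ : Measure α}
    {f w : α → ℝ≥0∞} (hf : AEMeasurable f μ) (hw : AEMeasurable w μ)
    (h0 : ∀ᵐ x ∂μ, w x ≠ 0) (ht : ∀ᵐ x ∂μ, w x ≠ ∞) :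
    μ.withDensity f = (μ.withDensity w).withDensity (fun x => f x * (w x)⁻¹) := by
  have hm : AEMeasurable (fun x => f x * (w x)⁻¹) μ := hf.mul hw.inv
  rw [← withDensity_mul₀ hw hm]
  refine withDensity_congr_ae ?_
  filter_upwards [h0, ht] with x h0 ht
  rw [Pi.mul_apply, mul_left_comm, ENNReal.mul_inv_cancel h0 ht, mul_one]

lemma withDensity_apply_ne_zero {α : Type*} [MeasurableSpace α] {μ : Measure α} [SFinite μ]
    {w : α → ℝ≥0∞} (hw : AEMeasurable w μ) (h0 : ∀ᵐ x ∂μ, w x ≠ 0) {s : Set α}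
    (hs : μ s ≠ 0) : μ.withDensity w s ≠ 0 := by
  intro h
  exact hs ((withDensity_absolutelyContinuous' hw h0) h)

/-- Pointwise domination of the Hardy–Littlewood maximal function by weighted ones. -/
lemma hlMax_rpow_le {n : ℕ} {q : ℝ} (hq : 1 < q) {K : ℝ≥0} {w σ : (Fin n → ℝ) → ℝ≥0∞}
    (hw : AEMeasurable w volume) (hw0 : ∀ᵐ x, w x ≠ 0)
    (hσ : AEMeasurable σ volume) (hσ0 : ∀ᵐ x, σ x ≠ 0)
    (hK : ∀ (c : Fin n → ℝ) (r : ℝ), 0 < r →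
      (⨍⁻ x in cube c r, w x ∂volume) * (⨍⁻ x in cube c r, σ x ∂volume) ^ (q - 1) ≤ K)
    (f : (Fin n → ℝ) → ℝ≥0∞) (x : Fin n → ℝ) :
    hlMax f x ^ (q - 1) ≤ K * 3 ^ n * (3 ^ n) ^ (q - 1) * maxFun (volume.withDensity w)
      (volume.withDensity fun y =>
        maxFun (volume.withDensity σ) (volume.withDensity f) y ^ (q - 1)) x := by
  have hq1 : 0 < q - 1 := by linarith
  rw [← ENNReal.le_rpow_inv_iff hq1]
  refine iSup_le fun ⟨r, hr⟩ => ?_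
  rw [ENNReal.le_rpow_inv_iff hq1]
  refine le_trans ?_ (mul_le_mul_right (le_maxFun _ _ x hr) _)
  have hr' : (0 : ℝ) < r := by exact_mod_cast hr
  set g := maxFun (volume.withDensity σ) (volume.withDensity f) with hg
  set Q := Metric.closedBall x (r : ℝ) with hQ
  set Q3 := Metric.closedBall x (3 * r : ℝ) with hQ3
  set ω := volume.withDensity w with hω
  set μ := volume.withDensity σ with hμ
  set ν := volume.withDensity f with hν
  have hv0 : volume Q ≠ 0 := volume_closedBall_pos x hr'
  have hvt : volume Q ≠ ∞ := volume_closedBall_lt_top x _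
  have hv3 : volume Q3 = 3 ^ n * volume Q := volume_closedBall_three_mul x hr'.le
  have hv30 : volume Q3 ≠ 0 := volume_closedBall_pos x (by positivity)
  have hv3t : volume Q3 ≠ ∞ := volume_closedBall_lt_top x _
  have hQQ3 : Q ⊆ Q3 := Metric.closedBall_subset_closedBall (by linarith)
  have hA : ω Q3 / volume Q3 * (μ Q3 / volume Q3) ^ (q - 1) ≤ K := by
    have := hK x (3 * r) (by positivity)
    rwa [cube_eq_closedBall _ (by positivity), setLAverage_eq, setLAverage_eq,
      ← withDensity_apply', ← withDensity_apply'] at this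
  have hω0 : ω Q3 ≠ 0 := withDensity_apply_ne_zero hw hw0 hv30
  have hωQ0 : ω Q ≠ 0 := withDensity_apply_ne_zero hw hw0 hv0
  have hμ0 : μ Q3 ≠ 0 := withDensity_apply_ne_zero hσ hσ0 hv30
  -- Finiteness of both masses is read off from the `A_q` bound `hA`, since neither factor there
  -- vanishes.
  have hωt : ω Q3 ≠ ∞ := by
    intro h
    rw [h, ENNReal.top_div_of_ne_top hv3t, ENNReal.top_mul] at hA
    · exact absurd hA (by simp)
    · exact (ENNReal.rpow_pos_of_nonneg (ENNReal.div_pos hμ0 hv3t) hq1.le).ne'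
  have hμt : μ Q3 ≠ ∞ := by
    intro h
    rw [h, ENNReal.top_div_of_ne_top hv3t, ENNReal.top_rpow_of_pos hq1, ENNReal.mul_top] at hA
    · exact absurd hA (by simp)
    · exact (ENNReal.div_pos hω0 hv3t).ne'
  have hωQt : ω Q ≠ ∞ := ((measure_mono hQQ3).trans_lt hωt.lt_top).ne
  -- The ball of radius `2 * r` about `y` contains `Q` and lies in `Q3`, so the centred maximal
  -- function at every point of `Q` sees this quotient.
  have hgQ : ∀ y ∈ Q, ν Q / μ Q3 ≤ g y := by
    intro y hy
    have hy' : dist y x ≤ r := hy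
    refine le_trans ?_ (le_maxFun μ ν y (r := 2 * r) (by positivity))
    refine ENNReal.div_le_div (measure_mono ?_) (measure_mono ?_) <;> push_cast
    · exact Metric.closedBall_subset_closedBall' (by rw [dist_comm]; linarith)
    · exact Metric.closedBall_subset_closedBall' (by linarith)
  have hτ : (ν Q / μ Q3) ^ (q - 1) * volume Q ≤ volume.withDensity (fun y => g y ^ (q - 1)) Q := by
    rw [withDensity_apply' (fun y => g y ^ (q - 1)), ← setLIntegral_const]
    exact setLIntegral_mono' Metric.isClosed_closedBall.measurableSet fun y hy =>
      ENNReal.rpow_le_rpow (hgQ y hy) hq1.le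
  rw [← mul_div_assoc, ENNReal.le_div_iff_mul_le (Or.inl hωQ0) (Or.inl hωQt)]
  have e1 : ν Q / volume Q = (ν Q / μ Q3) * (μ Q3 / volume Q3) * 3 ^ n := by
    rw [hv3]
    simp only [div_eq_mul_inv]
    rw [ENNReal.mul_inv (by simp) (by simp)]
    calc ν Q * (volume Q)⁻¹ = ν Q * (volume Q)⁻¹ * 1 * 1 := by ring
      _ = ν Q * (volume Q)⁻¹ * ((μ Q3)⁻¹ * μ Q3) * ((3 ^ n)⁻¹ * 3 ^ n) := by
        rw [ENNReal.inv_mul_cancel hμ0 hμt, ENNReal.inv_mul_cancel (by simp) (by simp)]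
      _ = _ := by ring
  rw [e1, ENNReal.mul_rpow_of_nonneg _ _ hq1.le, ENNReal.mul_rpow_of_nonneg _ _ hq1.le]
  have e2 : ω Q3 = ω Q3 / volume Q3 * (3 ^ n * volume Q) := by
    rw [← hv3, ENNReal.div_mul_cancel hv30 hv3t]
  calc (ν Q / μ Q3) ^ (q - 1) * (μ Q3 / volume Q3) ^ (q - 1) * (3 ^ n) ^ (q - 1) * ω Q
      ≤ (ν Q / μ Q3) ^ (q - 1) * (μ Q3 / volume Q3) ^ (q - 1) * (3 ^ n) ^ (q - 1) * ω Q3 := by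
        gcongr
    _ = (ω Q3 / volume Q3 * (μ Q3 / volume Q3) ^ (q - 1)) * 3 ^ n * (3 ^ n) ^ (q - 1) *
          ((ν Q / μ Q3) ^ (q - 1) * volume Q) := by
        conv_lhs => rw [e2]
        ring
    _ ≤ _ := by gcongr

/-- Muckenhoupt's theorem: the maximal operator is bounded on `L^q(w)` for `w ∈ A_q`, `q > 1`, with
a bound depending only on the dimension, `q` and the `A_q` constant. -/
lemma exists_weighted_hlMax_bound (n : ℕ) {q : ℝ} (hq : 1 < q) (K : ℝ≥0) :
    ∃ C : ℝ≥0, ∀ w σ : (Fin n → ℝ) → ℝ≥0∞, AEMeasurable w volume →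
      (∀ᵐ x, w x ≠ 0) → (∀ᵐ x, w x ≠ ∞) →
      (∀ᵐ x, σ x = w x ^ (-1 / (q - 1))) → AEMeasurable σ volume →
      (∀ (c : Fin n → ℝ) (r : ℝ), 0 < r →
        (⨍⁻ x in cube c r, w x ∂volume) * (⨍⁻ x in cube c r, σ x ∂volume) ^ (q - 1) ≤ K) →
      ∀ f : (Fin n → ℝ) → ℝ≥0∞, AEMeasurable f volume →
        ∫⁻ x, hlMax f x ^ q * w x ≤ C * ∫⁻ x, f x ^ q * w x := by
  have hq1 : 0 < q - 1 := by linarith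
  have hq' : 1 < q / (q - 1) := by rw [lt_div_iff₀ hq1]; linarith
  obtain ⟨C₁, hC₁⟩ := exists_strong_type_maxFun (Fin n → ℝ) hq
  obtain ⟨C₂, hC₂⟩ := exists_strong_type_maxFun (Fin n → ℝ) hq'
  refine ⟨(K * 3 ^ n * (3 ^ n) ^ (q - 1)) ^ (q / (q - 1)) * (C₂ * C₁),
    fun w σ hw hw0 hwt hσw hσ hK f hf => ?_⟩
  have hσ0 : ∀ᵐ x, σ x ≠ 0 := by
    filter_upwards [hσw, hw0, hwt] with x h h0 ht
    rw [h]
    exact (ENNReal.rpow_pos (pos_iff_ne_zero.2 h0) ht).ne'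
  have hσt : ∀ᵐ x, σ x ≠ ∞ := by
    filter_upwards [hσw, hw0, hwt] with x h h0 ht
    rw [h]
    exact ENNReal.rpow_ne_top_of_ne_zero h0 ht
  set μ := volume.withDensity σ with hμ
  set ω := volume.withDensity w with hω
  set g := maxFun μ (volume.withDensity f) with hg
  have hgm : Measurable g := measurable_maxFun _ _
  set τ := volume.withDensity fun y => g y ^ (q - 1) with hτ
  have hτω : τ = ω.withDensity (fun y => g y ^ (q - 1) * (w y)⁻¹) :=
    withDensity_eq_withDensity_withDensity (hgm.pow_const _).aemeasurable hw hw0 hwt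
  have hνμ : volume.withDensity f = μ.withDensity (fun y => f y * (σ y)⁻¹) :=
    withDensity_eq_withDensity_withDensity hf hσ hσ0 hσt
  have hint : ∀ (u : (Fin n → ℝ) → ℝ≥0∞), AEMeasurable u volume → ∀ (φ : (Fin n → ℝ) → ℝ≥0∞),
      AEMeasurable φ volume →
      ∫⁻ x, φ x ∂(volume.withDensity u) = ∫⁻ x, φ x * u x := by
    intro u hu φ hφ
    rw [lintegral_withDensity_eq_lintegral_mul₀ hu hφ]
    simp [mul_comm]
  set B : ℝ≥0∞ := K * 3 ^ n * (3 ^ n) ^ (q - 1) with hB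
  have hqq : 0 ≤ q / (q - 1) := by linarith
  have hm₁ : AEMeasurable (fun x => maxFun ω τ x ^ (q / (q - 1))) volume :=
    ((measurable_maxFun _ _).pow_const _).aemeasurable
  have hm₂ : AEMeasurable (fun x => g x ^ (q - 1) * (w x)⁻¹) volume :=
    (hgm.pow_const _).aemeasurable.mul hw.inv
  have hm₃ : AEMeasurable (fun x => f x * (σ x)⁻¹) volume := hf.mul hσ.inv
  -- With `q' = q / (q - 1)`, the maximal operator of `ω` acts on `L^{q'}(ω)` and that of `μ` on
  -- `L^q(μ)`. The identities `w^{1-q'} = σ` and `σ^{1-q} = w` carry one integral into the next.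
  calc ∫⁻ x, hlMax f x ^ q * w x
      ≤ ∫⁻ x, B ^ (q / (q - 1)) * (maxFun ω τ x ^ (q / (q - 1)) * w x) := by
        refine lintegral_mono fun x => ?_
        rw [← mul_assoc, ← ENNReal.mul_rpow_of_nonneg _ _ hqq]
        gcongr
        have := hlMax_rpow_le hq hw hw0 hσ hσ0 hK f x
        calc hlMax f x ^ q = (hlMax f x ^ (q - 1)) ^ (q / (q - 1)) := by
              rw [← ENNReal.rpow_mul, mul_div_cancel₀ _ hq1.ne']
          _ ≤ _ := ENNReal.rpow_le_rpow this hqq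
    _ = B ^ (q / (q - 1)) * ∫⁻ x, maxFun ω τ x ^ (q / (q - 1)) ∂ω := by
        rw [hint w hw _ hm₁]
        exact lintegral_const_mul'' _ (hm₁.mul hw)
    _ ≤ B ^ (q / (q - 1)) * (C₂ * ∫⁻ x, (g x ^ (q - 1) * (w x)⁻¹) ^ (q / (q - 1)) ∂ω) := by
        gcongr
        rw [hτω]
        exact hC₂ ω _ (hm₂.mono_ac (withDensity_absolutelyContinuous _ _))
    _ = B ^ (q / (q - 1)) * (C₂ * ∫⁻ x, g x ^ q ∂μ) := by
        congr 2
        rw [hint w hw _ (hm₂.pow_const _),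
          hint σ hσ _ (hgm.pow_const _).aemeasurable]
        refine lintegral_congr_ae ?_
        filter_upwards [hw0, hwt, hσw] with x h0 ht hs
        rw [ENNReal.mul_rpow_of_nonneg _ _ hqq, ← ENNReal.rpow_mul, mul_div_cancel₀ _ hq1.ne',
          mul_assoc, hs, ENNReal.inv_rpow, ← ENNReal.rpow_neg]
        congr 1
        conv_lhs => rw [← ENNReal.rpow_one (w x), ← ENNReal.rpow_mul, ← ENNReal.rpow_add _ _ h0 ht]
        congr 1
        field_simp
        ring
    _ ≤ B ^ (q / (q - 1)) * (C₂ * (C₁ * ∫⁻ x, (f x * (σ x)⁻¹) ^ q ∂μ)) := by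
        gcongr
        rw [hg, hνμ]
        exact hC₁ μ _ (hm₃.mono_ac (withDensity_absolutelyContinuous _ _))
    _ = B ^ (q / (q - 1)) * (C₂ * (C₁ * ∫⁻ x, f x ^ q * w x)) := by
        congr 3
        rw [hint σ hσ _ (hm₃.pow_const _)]
        refine lintegral_congr_ae ?_
        filter_upwards [hw0, hwt, hσw] with x h0 ht hs
        rw [ENNReal.mul_rpow_of_nonneg _ _ (by linarith), mul_assoc, hs, ENNReal.inv_rpow,
          ← ENNReal.rpow_neg, ← ENNReal.rpow_mul, ← ENNReal.rpow_add _ _ h0 ht]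
        congr 1
        conv_rhs => rw [← ENNReal.rpow_one (w x)]
        congr 1
        field_simp
        ring
    _ = _ := by
        rw [ENNReal.coe_mul, ENNReal.coe_rpow_of_nonneg _ hqq, ENNReal.coe_mul, ENNReal.coe_mul,
          ENNReal.coe_mul, ENNReal.coe_rpow_of_nonneg _ hq1.le, hB]
        push_cast
        ring

/-! ### `A₁` functions and the Rubio de Francia algorithm -/

/-- A function satisfying the `A₁` condition pointwise on every cube with constant `A`. -/
structure IsA1Function {n : ℕ} (A : ℝ≥0) (F : (Fin n → ℝ) → ℝ≥0∞) : Prop where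
  aemeasurable : AEMeasurable F volume
  ne_zero : ∀ᵐ x, F x ≠ 0
  ne_top : ∀ᵐ x, F x ≠ ∞
  avg_le : ∀ (c : Fin n → ℝ) (r : ℝ), 0 < r → ∀ x ∈ cube c r,
    ⨍⁻ y in cube c r, F y ∂volume ≤ A * F x

lemma measurable_hlMax {n : ℕ} (f : (Fin n → ℝ) → ℝ≥0∞) : Measurable (hlMax f) :=
  measurable_maxFun _ _

lemma setLAverage_cube_le_hlMax {n : ℕ} (f : (Fin n → ℝ) → ℝ≥0∞) (c : Fin n → ℝ) {r : ℝ}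
    (hr : 0 < r) {x : Fin n → ℝ} (hx : x ∈ cube c r) :
    ⨍⁻ y in cube c r, f y ∂volume ≤ 3 ^ n * hlMax f x := by
  -- The maximal function uses rational radii. A radius of at least `2 * r` about `x` covers the
  -- cube, and one below `3 * r` costs at most the factor `3 ^ n`.
  obtain ⟨s, hs2, hs3⟩ := exists_rat_btwn (show 2 * r < 3 * r by linarith)
  have hs : 0 < s := by
    have : (0 : ℝ) < s := by linarith
    exact_mod_cast this
  rw [cube_eq_closedBall _ hr.le] at hx ⊢
  have hx' : dist x c ≤ r := hx
  refine le_trans ?_ (mul_le_mul_right (le_maxFun _ _ x hs) _)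
  rw [setLAverage_eq, ← withDensity_apply']
  set ν := volume.withDensity f
  have h1 : ν (Metric.closedBall c r) ≤ ν (Metric.closedBall x s) := by
    refine measure_mono (Metric.closedBall_subset_closedBall' ?_)
    rw [dist_comm]
    linarith
  have h2 : volume (Metric.closedBall x (s : ℝ)) ≤ 3 ^ n * volume (Metric.closedBall c r) := by
    rw [← volume_closedBall_three_mul c hr.le, Measure.addHaar_closedBall_center volume x,
      Measure.addHaar_closedBall_center volume c]
    exact measure_mono (Metric.closedBall_subset_closedBall hs3.le)
  have hv0 := volume_closedBall_pos c hr
  have hvt := volume_closedBall_lt_top c r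
  have hs0 : volume (Metric.closedBall x (s : ℝ)) ≠ 0 :=
    volume_closedBall_pos x (by exact_mod_cast hs)
  calc ν (Metric.closedBall c r) / volume (Metric.closedBall c r)
      ≤ ν (Metric.closedBall x s) / volume (Metric.closedBall c r) := by gcongr
    _ = 3 ^ n * (ν (Metric.closedBall x s) / (3 ^ n * volume (Metric.closedBall c r))) := by
        simp only [div_eq_mul_inv]
        rw [ENNReal.mul_inv (by simp) (by simp)]
        calc _ = ν (Metric.closedBall x s) * 1 * (volume (Metric.closedBall c r))⁻¹ := by ring
          _ = ν (Metric.closedBall x s) * ((3 ^ n) * (3 ^ n)⁻¹) *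
              (volume (Metric.closedBall c r))⁻¹ := by
            rw [ENNReal.mul_inv_cancel (by simp) (by simp)]
          _ = _ := by ring
    _ ≤ _ := by gcongr

/-- The Rubio de Francia iteration algorithm. -/
lemma exists_rubioDeFrancia_majorant {n : ℕ} {q : ℝ} (hq : 1 ≤ q) {w : (Fin n → ℝ) → ℝ≥0∞}
    (hw : AEMeasurable w volume) {C : ℝ≥0}
    (hC : ∀ f : (Fin n → ℝ) → ℝ≥0∞, AEMeasurable f volume →
        ∫⁻ x, hlMax f x ^ q * w x ≤ C * ∫⁻ x, f x ^ q * w x)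
    {f : (Fin n → ℝ) → ℝ≥0∞} (hf : AEMeasurable f volume) :
    ∃ F : (Fin n → ℝ) → ℝ≥0∞, AEMeasurable F volume ∧ (∀ x, f x ≤ F x) ∧
      (∀ x, hlMax F x ≤ 2 * (C + 1) * F x) ∧
      ∫⁻ x, F x ^ q * w x ≤ 2 ^ q * ∫⁻ x, f x ^ q * w x := by
  have hq0 : 0 < q := by linarith
  -- `C` bounds `q`-th powers, so the operator norm is at most `C^{1/q}`. Since `D ≥ 1`, `D`
  -- dominates it without taking a root, and it may be divided by.
  set D : ℝ≥0∞ := C + 1 with hD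
  have hD0 : D ≠ 0 := by simp [hD]
  have hDt : D ≠ ∞ := by simp [hD]
  have hDC : (C : ℝ≥0∞) ≤ D ^ q := by
    calc (C : ℝ≥0∞) ≤ D := le_self_add
      _ = D ^ (1 : ℝ) := (ENNReal.rpow_one D).symm
      _ ≤ D ^ q := ENNReal.rpow_le_rpow_of_exponent_le (by simp [hD]) hq
  let a : ℕ → (Fin n → ℝ) → ℝ≥0∞ := fun k => hlMax^[k] f
  have ha0 : a 0 = f := rfl
  have hasucc : ∀ k, a (k + 1) = hlMax (a k) := fun k => Function.iterate_succ_apply' _ _ _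
  have ham : ∀ k, AEMeasurable (a k) volume := by
    intro k
    cases k with
    | zero => exact hf
    | succ k => rw [hasucc]; exact (measurable_hlMax _).aemeasurable
  set I := ∫⁻ x, f x ^ q * w x with hI
  have haI : ∀ k, ∫⁻ x, a k x ^ q * w x ≤ (D ^ k) ^ q * I := by
    intro k
    induction k with
    | zero => simp [ha0, hI]
    | succ k ih =>
      rw [hasucc]
      calc _ ≤ C * ∫⁻ x, a k x ^ q * w x := hC _ (ham k)
        _ ≤ D ^ q * ((D ^ k) ^ q * I) := by gcongr
        _ = _ := by rw [pow_succ, ENNReal.mul_rpow_of_nonneg _ _ hq0.le]; ring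
  have hgeom : ∑' k : ℕ, (2⁻¹ : ℝ≥0∞) ^ k = 2 := by
    rw [ENNReal.tsum_geometric, ENNReal.one_sub_inv_two, inv_inv]
  let b : ℕ → (Fin n → ℝ) → ℝ≥0∞ := fun k x => (D ^ k)⁻¹ * a k x
  have hbm : ∀ k, AEMeasurable (b k) volume := fun k => (ham k).const_mul _
  have hbI : ∀ k, ∫⁻ x, b k x ^ q * w x ≤ I := by
    intro k
    have hk0 : D ^ k ≠ 0 := pow_ne_zero _ hD0
    have hkt : D ^ k ≠ ∞ := ENNReal.pow_ne_top hDt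
    calc ∫⁻ x, b k x ^ q * w x = ∫⁻ x, ((D ^ k) ^ q)⁻¹ * (a k x ^ q * w x) := by
          refine lintegral_congr fun x => ?_
          rw [ENNReal.mul_rpow_of_nonneg _ _ hq0.le, ENNReal.inv_rpow, mul_assoc]
      _ = ((D ^ k) ^ q)⁻¹ * ∫⁻ x, a k x ^ q * w x :=
          lintegral_const_mul'' _ (((ham k).pow_const _).mul hw)
      _ ≤ ((D ^ k) ^ q)⁻¹ * ((D ^ k) ^ q * I) := by gcongr; exact haI k
      _ = I := by
          rw [← mul_assoc, ENNReal.inv_mul_cancel, one_mul]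
          · exact (ENNReal.rpow_pos (pos_iff_ne_zero.2 hk0) hkt).ne'
          · exact ENNReal.rpow_ne_top_of_nonneg hq0.le hkt
  -- This is the sum of `(2D)^{-k} M^k f`. The term `k = 0` is `f`, and applying `M` shifts the
  -- index at the cost of `2D`.
  refine ⟨fun x => ∑' k, 2⁻¹ ^ k * b k x, AEMeasurable.tsum fun k => (hbm k).const_mul _,
    fun x => ?_, fun x => ?_, ?_⟩
  · calc f x = 2⁻¹ ^ 0 * b 0 x := by simp [b, ha0]
      _ ≤ _ := ENNReal.le_tsum 0
  · refine iSup_le fun r => ?_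
    set B := Metric.closedBall x ((r : ℚ) : ℝ)
    rw [withDensity_apply', lintegral_tsum fun k => ((hbm k).const_mul _).restrict,
      div_eq_mul_inv, ← ENNReal.tsum_mul_right, ← ENNReal.tsum_mul_left]
    have hterm : ∀ k, (∫⁻ y in B, 2⁻¹ ^ k * b k y) * (volume B)⁻¹ ≤
        2 * D * (2⁻¹ ^ (k + 1) * b (k + 1) x) := by
      intro k
      have h1 : (∫⁻ y in B, a k y) * (volume B)⁻¹ ≤ a (k + 1) x := by
        rw [hasucc, ← div_eq_mul_inv, ← withDensity_apply']
        exact le_maxFun _ _ x r.2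
      have h2 : ∫⁻ y in B, 2⁻¹ ^ k * b k y = 2⁻¹ ^ k * (D ^ k)⁻¹ * ∫⁻ y in B, a k y := by
        rw [← lintegral_const_mul'' _ (ham k).restrict]
        exact lintegral_congr fun y => by simp only [b]; ring
      rw [h2]
      calc _ = 2⁻¹ ^ k * (D ^ k)⁻¹ * ((∫⁻ y in B, a k y) * (volume B)⁻¹) := by ring
        _ ≤ 2⁻¹ ^ k * (D ^ k)⁻¹ * a (k + 1) x := by gcongr
        _ = 2⁻¹ ^ k * (D ^ k)⁻¹ * a (k + 1) x * (2 * 2⁻¹) * (D * D⁻¹) := by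
            rw [ENNReal.mul_inv_cancel (by simp) (by simp), ENNReal.mul_inv_cancel hD0 hDt]
            simp
        _ = _ := by
            simp only [b, pow_succ]
            rw [ENNReal.mul_inv (Or.inr hDt) (Or.inr hD0)]
            ring
    refine (ENNReal.tsum_le_tsum hterm).trans ?_
    exact ENNReal.tsum_comp_le_tsum_of_injective (add_left_injective 1)
      (fun k => 2 * D * (2⁻¹ ^ k * b k x))
  -- Hölder's inequality with the weights `2^{-k}`, of total mass `2`, replaces Minkowski's
  -- inequality for the infinite sum.
  · have hpt : ∀ x, (∑' k, 2⁻¹ ^ k * b k x) ^ q ≤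
        2 ^ (q - 1) * ∑' k, 2⁻¹ ^ k * b k x ^ q := by
      intro x
      have : ∑' k, 2⁻¹ ^ k * b k x ≤
          2 ^ (1 - q⁻¹) * (∑' k, 2⁻¹ ^ k * b k x ^ q) ^ q⁻¹ := by
        rw [ENNReal.tsum_eq_iSup_nat]
        refine iSup_le fun m => ?_
        refine (ENNReal.inner_le_weight_mul_Lp_of_nonneg (Finset.range m) hq _ _).trans ?_
        have : 0 ≤ 1 - q⁻¹ := by linarith [inv_le_one_of_one_le₀ hq]
        gcongr
        · exact (ENNReal.sum_le_tsum _).trans hgeom.le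
        · exact ENNReal.sum_le_tsum _
      calc _ ≤ (2 ^ (1 - q⁻¹) * (∑' k, 2⁻¹ ^ k * b k x ^ q) ^ q⁻¹) ^ q :=
            ENNReal.rpow_le_rpow this hq0.le
        _ = _ := by
            rw [ENNReal.mul_rpow_of_nonneg _ _ hq0.le, ← ENNReal.rpow_mul, ← ENNReal.rpow_mul,
              inv_mul_cancel₀ hq0.ne', ENNReal.rpow_one, sub_mul, one_mul,
              inv_mul_cancel₀ hq0.ne']
    have hm : ∀ k, AEMeasurable (fun x => b k x ^ q * w x) volume :=
      fun k => ((hbm k).pow_const _).mul hw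
    calc ∫⁻ x, (∑' k, 2⁻¹ ^ k * b k x) ^ q * w x
        ≤ ∫⁻ x, 2 ^ (q - 1) * ∑' k, 2⁻¹ ^ k * (b k x ^ q * w x) := by
          refine lintegral_mono fun x => ?_
          refine (mul_le_mul_left (hpt x) _).trans (le_of_eq ?_)
          rw [mul_assoc, ← ENNReal.tsum_mul_right]
          simp_rw [mul_assoc]
      _ = 2 ^ (q - 1) * ∑' k, 2⁻¹ ^ k * ∫⁻ x, b k x ^ q * w x := by
          rw [lintegral_const_mul'' _ (AEMeasurable.tsum fun k => (hm k).const_mul _),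
            lintegral_tsum fun k => (hm k).const_mul _]
          simp_rw [fun k => lintegral_const_mul'' ((2 : ℝ≥0∞)⁻¹ ^ k) (hm k)]
      _ ≤ 2 ^ (q - 1) * ∑' k, 2⁻¹ ^ k * I := by
          gcongr with k
          exact hbI k
      _ = 2 ^ (q - 1) * (2 * I) := by rw [ENNReal.tsum_mul_right, hgeom]
      _ = 2 ^ q * I := by
          rw [← mul_assoc]
          congr 1
          conv_lhs => rw [← ENNReal.rpow_one 2, ← ENNReal.rpow_mul, one_mul,
            ← ENNReal.rpow_add _ _ (by simp) (by simp)]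
          congr 1
          ring

/-- A zero of `F` would be a zero of `hlMax F`, so `F` would vanish almost everywhere on all balls
about that point, contradicting `hf0`. Finiteness almost everywhere comes from the finite integral
of `F ^ q * w`. -/
lemma exists_isA1Function_majorant {n : ℕ} {q : ℝ} (hq : 1 ≤ q) {w : (Fin n → ℝ) → ℝ≥0∞}
    (hw : AEMeasurable w volume) (hw0 : ∀ᵐ x, w x ≠ 0) {C : ℝ≥0}
    (hC : ∀ f : (Fin n → ℝ) → ℝ≥0∞, AEMeasurable f volume →
        ∫⁻ x, hlMax f x ^ q * w x ≤ C * ∫⁻ x, f x ^ q * w x)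
    {f : (Fin n → ℝ) → ℝ≥0∞} (hf : AEMeasurable f volume)
    (hf0 : ∫⁻ x, f x ^ q * w x ≠ 0) (hft : ∫⁻ x, f x ^ q * w x ≠ ∞) :
    ∃ F : (Fin n → ℝ) → ℝ≥0∞, IsA1Function (3 ^ n * (2 * (C + 1))) F ∧ (∀ x, f x ≤ F x) ∧
      ∫⁻ x, F x ^ q * w x ≤ 2 ^ q * ∫⁻ x, f x ^ q * w x := by
  have hq0 : 0 < q := by linarith
  obtain ⟨F, hF, hfF, hMF, hFI⟩ := exists_rubioDeFrancia_majorant hq hw hC hf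
  have hFt : ∫⁻ x, F x ^ q * w x ≠ ∞ :=
    (hFI.trans_lt (ENNReal.mul_lt_top (ENNReal.rpow_lt_top_of_nonneg hq0.le (by simp))
      hft.lt_top)).ne
  refine ⟨F, ⟨hF, Filter.Eventually.of_forall fun x hx => ?_, ?_, fun c r hr x hx => ?_⟩, hfF, hFI⟩
  · have h0 : hlMax F x = 0 := by
      have := hMF x
      rw [hx, mul_zero] at this
      exact le_antisymm this bot_le
    have hball : ∀ k : ℕ, volume.withDensity F (Metric.closedBall x k) = 0 := by
      intro k
      have h1 : (0 : ℚ) < k + 1 := by positivity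
      have h2 := le_maxFun volume (volume.withDensity F) x h1
      change _ ≤ hlMax F x at h2
      rw [h0, nonpos_iff_eq_zero, ENNReal.div_eq_zero_iff] at h2
      have h3 := h2.resolve_right (volume_closedBall_lt_top x _)
      refine measure_mono_null (Metric.closedBall_subset_closedBall ?_) h3
      push_cast
      linarith
    have huniv : volume.withDensity F Set.univ = 0 := by
      rw [← Metric.iUnion_closedBall_nat x]
      exact measure_iUnion_null hball
    rw [withDensity_apply _ MeasurableSet.univ, Measure.restrict_univ,
      lintegral_eq_zero_iff' hF] at huniv
    apply hf0
    rw [lintegral_congr_ae (g := 0), Pi.zero_def, lintegral_zero]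
    filter_upwards [huniv] with y hy
    have : f y = 0 := le_antisymm ((hfF y).trans hy.le) bot_le
    simp [this, hq0]
  · filter_upwards [ae_lt_top' ((hF.pow_const q).mul hw) hFt, hw0] with x hx hw hFx
    rw [Pi.mul_apply, hFx, ENNReal.top_rpow_of_pos hq0, ENNReal.top_mul hw] at hx
    exact lt_irrefl _ hx
  · refine (setLAverage_cube_le_hlMax F c hr hx).trans ?_
    push_cast
    rw [mul_assoc]
    gcongr
    exact hMF x

/-! ### Constructing Muckenhoupt weights from `A₁` functions -/

section Weights

variable {n : ℕ}

lemma isWeight_ne_zero {w : (Fin n → ℝ) → ℝ≥0∞} (hw : IsWeight w) : ∀ᵐ x, w x ≠ 0 := by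
  filter_upwards [hw.pos] with x hx using hx.ne'

lemma volume_cube_ne_zero (c : Fin n → ℝ) {r : ℝ} (hr : 0 < r) : volume (cube c r) ≠ 0 := by
  rw [cube_eq_closedBall c hr.le]
  exact volume_closedBall_pos c hr

lemma volume_cube_ne_top (c : Fin n → ℝ) {r : ℝ} (hr : 0 < r) : volume (cube c r) ≠ ∞ := by
  rw [cube_eq_closedBall c hr.le]
  exact volume_closedBall_lt_top c r

lemma measurableSet_cube (c : Fin n → ℝ) (r : ℝ) : MeasurableSet (cube c r) := measurableSet_Icc

lemma isWeight_ne_top {w : (Fin n → ℝ) → ℝ≥0∞} (hw : IsWeight w) : ∀ᵐ x, w x ≠ ∞ := by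
  have h : ∀ k : ℕ, ∀ᵐ x, x ∈ cube (0 : Fin n → ℝ) (k + 1) → w x ≠ ∞ := by
    intro k
    rw [← ae_restrict_iff' (measurableSet_cube _ _)]
    filter_upwards [ae_lt_top' hw.aemeasurable.restrict
      (hw.locallyIntegrable 0 (k + 1) (by positivity)).ne] with x hx using hx.ne
  filter_upwards [ae_all_iff.2 h] with x hx
  obtain ⟨k, hk⟩ := exists_nat_ge (dist x 0)
  refine hx k ?_
  rw [cube_eq_closedBall _ (by positivity), Metric.mem_closedBall]
  linarith

/-- The uniform probability measure on a cube. -/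
noncomputable def cubeAvg (c : Fin n → ℝ) (r : ℝ) : Measure (Fin n → ℝ) :=
  (volume.restrict (cube c r) Set.univ)⁻¹ • volume.restrict (cube c r)

lemma cubeAvg_absolutelyContinuous_restrict (c : Fin n → ℝ) (r : ℝ) :
    cubeAvg c r ≪ volume.restrict (cube c r) := Measure.smul_absolutelyContinuous

lemma cubeAvg_absolutelyContinuous (c : Fin n → ℝ) (r : ℝ) : cubeAvg c r ≪ volume :=
  (cubeAvg_absolutelyContinuous_restrict c r).trans Measure.restrict_le_self.absolutelyContinuous

lemma isProbabilityMeasure_cubeAvg (c : Fin n → ℝ) {r : ℝ} (hr : 0 < r) :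
    IsProbabilityMeasure (cubeAvg c r) := by
  constructor
  rw [cubeAvg, Measure.smul_apply, Measure.restrict_apply_univ, smul_eq_mul,
    ENNReal.inv_mul_cancel (volume_cube_ne_zero c hr) (volume_cube_ne_top c hr)]

lemma ae_cubeAvg_mem (c : Fin n → ℝ) (r : ℝ) : ∀ᵐ x ∂(cubeAvg c r), x ∈ cube c r :=
  (cubeAvg_absolutelyContinuous_restrict c r).ae_le (ae_restrict_mem (measurableSet_cube c r))

lemma lintegral_cubeAvg_ne_zero {f : (Fin n → ℝ) → ℝ≥0∞} (hf : AEMeasurable f volume)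
    (hf0 : ∀ᵐ x, f x ≠ 0) (c : Fin n → ℝ) {r : ℝ} (hr : 0 < r) :
    ∫⁻ x, f x ∂(cubeAvg c r) ≠ 0 := by
  have := isProbabilityMeasure_cubeAvg c hr
  intro h
  rw [lintegral_eq_zero_iff' (hf.mono_ac (cubeAvg_absolutelyContinuous c r))] at h
  have : ∀ᵐ x ∂(cubeAvg c r), False := by
    filter_upwards [h, (cubeAvg_absolutelyContinuous c r).ae_le hf0] with x h1 h2
    exact h2 h1
  simp at this
  exact IsProbabilityMeasure.ne_zero _ this

lemma setLIntegral_lt_top_of_cubeAvg {f : (Fin n → ℝ) → ℝ≥0∞} (c : Fin n → ℝ) {r : ℝ} (hr : 0 < r)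
    (h : ∫⁻ x, f x ∂(cubeAvg c r) ≠ ∞) : ∫⁻ x in cube c r, f x < ∞ := by
  rw [cubeAvg, lintegral_smul_measure, Measure.restrict_apply_univ, smul_eq_mul] at h
  by_contra hcon
  rw [not_lt, top_le_iff] at hcon
  rw [hcon, ENNReal.mul_top] at h
  · exact h rfl
  · exact ENNReal.inv_ne_zero.2 (volume_cube_ne_top c hr)

lemma lintegral_cubeAvg_ne_top {f : (Fin n → ℝ) → ℝ≥0∞} (c : Fin n → ℝ) {r : ℝ} (hr : 0 < r)
    (h : ∫⁻ x in cube c r, f x < ∞) : ∫⁻ x, f x ∂(cubeAvg c r) ≠ ∞ := by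
  rw [cubeAvg, lintegral_smul_measure, Measure.restrict_apply_univ, smul_eq_mul]
  exact ENNReal.mul_ne_top (ENNReal.inv_ne_top.2 (volume_cube_ne_zero c hr)) h.ne

lemma apConst_le_iff {p : ℝ} (hp : p ≠ 1) {w : (Fin n → ℝ) → ℝ≥0∞} {K : ℝ≥0∞} :
    apConst p w ≤ K ↔ ∀ (c : Fin n → ℝ) (r : ℝ), 0 < r → (∫⁻ x, w x ∂(cubeAvg c r)) *
      (∫⁻ x, w x ^ (-1 / (p - 1)) ∂(cubeAvg c r)) ^ (p - 1) ≤ K := by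
  rw [apConst, if_neg hp]
  simp only [iSup_le_iff]
  rfl

lemma apConst_one_le_iff {w : (Fin n → ℝ) → ℝ≥0∞} {K : ℝ≥0∞} :
    apConst 1 w ≤ K ↔ ∀ (c : Fin n → ℝ) (r : ℝ), 0 < r → (∫⁻ x, w x ∂(cubeAvg c r)) *
      essSup (fun x => (w x)⁻¹) (volume.restrict (cube c r)) ≤ K := by
  rw [apConst, if_pos rfl]
  simp only [iSup_le_iff]
  rfl

lemma IsA1Function.lintegral_le {A : ℝ≥0} {F : (Fin n → ℝ) → ℝ≥0∞} (hF : IsA1Function A F)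
    (c : Fin n → ℝ) {r : ℝ} (hr : 0 < r) {x : Fin n → ℝ} (hx : x ∈ cube c r) :
    ∫⁻ y, F y ∂(cubeAvg c r) ≤ A * F x := hF.avg_le c r hr x hx

lemma IsA1Function.lintegral_ne_top {A : ℝ≥0} {F : (Fin n → ℝ) → ℝ≥0∞} (hF : IsA1Function A F)
    (c : Fin n → ℝ) {r : ℝ} (hr : 0 < r) : ∫⁻ y, F y ∂(cubeAvg c r) ≠ ∞ := by
  have := isProbabilityMeasure_cubeAvg c hr
  obtain ⟨x, hx, hxt⟩ := ((ae_cubeAvg_mem c r).and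
    ((cubeAvg_absolutelyContinuous c r).ae_le hF.ne_top)).exists
  exact ((hF.lintegral_le c hr hx).trans_lt (ENNReal.mul_lt_top (by simp) hxt.lt_top)).ne

/-- The reciprocal of an `A₁` function is controlled by the reciprocal of its average. -/
lemma IsA1Function.inv_le {A : ℝ≥0} {F : (Fin n → ℝ) → ℝ≥0∞} (hF : IsA1Function A F)
    (c : Fin n → ℝ) {r : ℝ} (hr : 0 < r) {x : Fin n → ℝ} (hx : x ∈ cube c r) :
    (F x)⁻¹ ≤ A * (∫⁻ y, F y ∂(cubeAvg c r))⁻¹ := by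
  set a := ∫⁻ y, F y ∂(cubeAvg c r) with ha
  have ha0 : a ≠ 0 := lintegral_cubeAvg_ne_zero hF.aemeasurable hF.ne_zero c hr
  have hat : a ≠ ∞ := hF.lintegral_ne_top c hr
  calc (F x)⁻¹ = (F x)⁻¹ * (a * a⁻¹) := by rw [ENNReal.mul_inv_cancel ha0 hat, mul_one]
    _ ≤ (F x)⁻¹ * (A * F x * a⁻¹) := by gcongr; exact hF.lintegral_le c hr hx
    _ = (F x * (F x)⁻¹) * (A * a⁻¹) := by ring
    _ ≤ 1 * (A * a⁻¹) := by gcongr; exact ENNReal.mul_inv_le_one _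
    _ = _ := one_mul _

/-- If `w ∈ A_q` and `F ∈ A₁` then `w F^{q-p} ∈ A_p` for `p > q`. -/
lemma memAp_mul_rpow_of_lt {q p : ℝ} (hq : 1 < q) (hqp : q < p) {w F : (Fin n → ℝ) → ℝ≥0∞}
    {A K : ℝ≥0} (hw : IsWeight w) (hK : apConst q w ≤ K) (hF : IsA1Function A F) :
    MemAp p (fun x => w x * F x ^ (q - p)) ∧
      apConst p (fun x => w x * F x ^ (q - p)) ≤ (K * A ^ (p - q) : ℝ≥0) := by
  have hs : 0 < p - q := by linarith
  have hp1 : 0 < p - 1 := by linarith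
  have hq1 : 0 < q - 1 := by linarith
  have hw0 := isWeight_ne_zero hw
  have hwt := isWeight_ne_top hw
  rw [apConst_le_iff hq.ne'] at hK
  have hum : AEMeasurable (fun x => w x * F x ^ (q - p)) volume :=
    hw.aemeasurable.mul (hF.aemeasurable.pow_const _)
  have havg : ∀ (c : Fin n → ℝ) (r : ℝ), 0 < r → ∫⁻ x, w x * F x ^ (q - p) ∂(cubeAvg c r) ≤
      (A * (∫⁻ y, F y ∂(cubeAvg c r))⁻¹) ^ (p - q) * ∫⁻ x, w x ∂(cubeAvg c r) := by
    intro c r hr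
    rw [← lintegral_const_mul'' _ (hw.aemeasurable.mono_ac (cubeAvg_absolutelyContinuous c r))]
    refine lintegral_mono_ae ?_
    filter_upwards [ae_cubeAvg_mem c r] with x hx
    rw [mul_comm]
    gcongr
    rw [← neg_sub, ENNReal.rpow_neg, ← ENNReal.inv_rpow]
    exact ENNReal.rpow_le_rpow (hF.inv_le c hr hx) hs.le
  have hconst : apConst p (fun x => w x * F x ^ (q - p)) ≤ (K * A ^ (p - q) : ℝ≥0) := by
    rw [apConst_le_iff (by linarith)]
    intro c r hr
    set a := ∫⁻ y, F y ∂(cubeAvg c r) with ha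
    have ha0 : a ≠ 0 := lintegral_cubeAvg_ne_zero hF.aemeasurable hF.ne_zero c hr
    have hat : a ≠ ∞ := hF.lintegral_ne_top c hr
    -- Hölder with exponents `(q-1)/(p-1)` and `(p-q)/(p-1)`. The power of the average `a` produced
    -- here cancels the one in `havg`.
    have hdual : (∫⁻ x, (w x * F x ^ (q - p)) ^ (-1 / (p - 1)) ∂(cubeAvg c r)) ^ (p - 1) ≤
        (∫⁻ x, w x ^ (-1 / (q - 1)) ∂(cubeAvg c r)) ^ (q - 1) * a ^ (p - q) := by
      have hac := cubeAvg_absolutelyContinuous c r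
      have h1 : ∫⁻ x, (w x * F x ^ (q - p)) ^ (-1 / (p - 1)) ∂(cubeAvg c r) ≤
          (∫⁻ x, w x ^ (-1 / (q - 1)) ∂(cubeAvg c r)) ^ ((q - 1) / (p - 1)) *
            a ^ ((p - q) / (p - 1)) := by
        refine le_trans (le_of_eq ?_) (ENNReal.lintegral_mul_norm_pow_le
          ((hw.aemeasurable.mono_ac hac).pow_const _) (hF.aemeasurable.mono_ac hac)
          (by positivity) (by positivity) (by field_simp; ring))
        refine lintegral_congr_ae ?_
        filter_upwards [hac.ae_le hw0, hac.ae_le hwt, hac.ae_le hF.ne_zero,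
          hac.ae_le hF.ne_top] with x hw0 hwt hF0 hFt
        rw [ENNReal.mul_rpow_of_ne_top hwt (ENNReal.rpow_ne_top_of_ne_zero hF0 hFt),
          ← ENNReal.rpow_mul, ← ENNReal.rpow_mul]
        congr 2
        · field_simp
        · field_simp
          ring
      calc _ ≤ ((∫⁻ x, w x ^ (-1 / (q - 1)) ∂(cubeAvg c r)) ^ ((q - 1) / (p - 1)) *
            a ^ ((p - q) / (p - 1))) ^ (p - 1) := ENNReal.rpow_le_rpow h1 hp1.le
        _ = _ := by
            rw [ENNReal.mul_rpow_of_nonneg _ _ hp1.le, ← ENNReal.rpow_mul, ← ENNReal.rpow_mul,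
              div_mul_cancel₀ _ hp1.ne', div_mul_cancel₀ _ hp1.ne']
    calc _ ≤ ((A * a⁻¹) ^ (p - q) * ∫⁻ x, w x ∂(cubeAvg c r)) *
          ((∫⁻ x, w x ^ (-1 / (q - 1)) ∂(cubeAvg c r)) ^ (q - 1) * a ^ (p - q)) := by
          gcongr
          exact havg c r hr
      _ = ((∫⁻ x, w x ∂(cubeAvg c r)) *
            (∫⁻ x, w x ^ (-1 / (q - 1)) ∂(cubeAvg c r)) ^ (q - 1)) *
              (A * (a⁻¹ * a)) ^ (p - q) := by
          rw [← mul_assoc (A : ℝ≥0∞)]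
          rw [ENNReal.mul_rpow_of_nonneg _ a hs.le]
          ring
      _ ≤ K * A ^ (p - q) := by
          rw [ENNReal.inv_mul_cancel ha0 hat, mul_one]
          gcongr
          exact hK c r hr
      _ = _ := by rw [ENNReal.coe_mul, ENNReal.coe_rpow_of_nonneg _ hs.le]
  refine ⟨⟨⟨hum, ?_, fun c r hr => ?_⟩, hconst.trans_lt ENNReal.coe_lt_top⟩, hconst⟩
  · filter_upwards [hw0, hF.ne_zero, hF.ne_top] with x hw0 hF0 hFt
    exact ENNReal.mul_pos hw0 (ENNReal.rpow_pos (pos_iff_ne_zero.2 hF0) hFt).ne'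
  · have ha0 := lintegral_cubeAvg_ne_zero hF.aemeasurable hF.ne_zero c hr
    refine setLIntegral_lt_top_of_cubeAvg c hr ((havg c r hr).trans_lt ?_).ne
    exact ENNReal.mul_lt_top (ENNReal.rpow_lt_top_of_nonneg hs.le
      (ENNReal.mul_ne_top (by simp) (ENNReal.inv_ne_top.2 ha0)))
      (lintegral_cubeAvg_ne_top c hr (hw.locallyIntegrable c r hr)).lt_top

/-- If `w ∈ A_q` and `F ∈ A₁` then `F^θ w^{1-θ} ∈ A_p` for `1 ≤ p < q` and
`θ = (q - p) / (q - 1)`. -/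
lemma memAp_rpow_mul_rpow_of_lt {q p : ℝ} (hp : 1 ≤ p) (hpq : p < q)
    {w F : (Fin n → ℝ) → ℝ≥0∞} {A K : ℝ≥0} (hw : IsWeight w) (hK : apConst q w ≤ K)
    (hF : IsA1Function A F) :
    MemAp p (fun x => F x ^ ((q - p) / (q - 1)) * w x ^ ((p - 1) / (q - 1))) ∧
      apConst p (fun x => F x ^ ((q - p) / (q - 1)) * w x ^ ((p - 1) / (q - 1))) ≤
        (A ^ ((q - p) / (q - 1)) * K ^ ((p - 1) / (q - 1)) : ℝ≥0) := by
  have hq1 : 0 < q - 1 := by linarith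
  set θ := (q - p) / (q - 1) with hθ
  set η := (p - 1) / (q - 1) with hη
  have hθ0 : 0 < θ := div_pos (by linarith) hq1
  have hη0 : 0 ≤ η := div_nonneg (by linarith) hq1.le
  have hsum : θ + η = 1 := by rw [hθ, hη]; field_simp; ring
  have hw0 := isWeight_ne_zero hw
  have hwt := isWeight_ne_top hw
  rw [apConst_le_iff (by linarith)] at hK
  set u : (Fin n → ℝ) → ℝ≥0∞ := fun x => F x ^ θ * w x ^ η with hu
  have hum : AEMeasurable u volume :=
    (hF.aemeasurable.pow_const _).mul (hw.aemeasurable.pow_const _)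
  have hu0 : ∀ᵐ x, u x ≠ 0 := by
    filter_upwards [hw0, hwt, hF.ne_zero, hF.ne_top] with x hw0 hwt hF0 hFt
    exact mul_ne_zero (ENNReal.rpow_pos (pos_iff_ne_zero.2 hF0) hFt).ne'
      (ENNReal.rpow_pos (pos_iff_ne_zero.2 hw0) hwt).ne'
  have havg : ∀ (c : Fin n → ℝ) (r : ℝ), 0 < r → ∫⁻ x, u x ∂(cubeAvg c r) ≤
      (∫⁻ y, F y ∂(cubeAvg c r)) ^ θ * (∫⁻ x, w x ∂(cubeAvg c r)) ^ η := by
    intro c r hr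
    have hac := cubeAvg_absolutelyContinuous c r
    exact ENNReal.lintegral_mul_norm_pow_le (hF.aemeasurable.mono_ac hac)
      (hw.aemeasurable.mono_ac hac) hθ0.le hη0 hsum
  -- A pointwise bound serves both forms of the constant: the essential supremum for `p = 1` and the
  -- average of a negative power for `p > 1`.
  have huinv : ∀ (c : Fin n → ℝ) (r : ℝ), 0 < r → ∀ᵐ x ∂(volume.restrict (cube c r)),
      (u x)⁻¹ ≤ (A * (∫⁻ y, F y ∂(cubeAvg c r))⁻¹) ^ θ * (w x)⁻¹ ^ η := by
    intro c r hr
    filter_upwards [ae_restrict_mem (measurableSet_cube c r), ae_restrict_of_ae hw0,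
      ae_restrict_of_ae hwt] with x hx hw0 hwt
    rw [hu, ENNReal.mul_inv (Or.inr (ENNReal.rpow_ne_top_of_ne_zero hw0 hwt))
      (Or.inr (ENNReal.rpow_pos (pos_iff_ne_zero.2 hw0) hwt).ne'), ← ENNReal.inv_rpow,
      ← ENNReal.inv_rpow]
    gcongr
    exact hF.inv_le c hr hx
  have hconst : apConst p u ≤ (A ^ θ * K ^ η : ℝ≥0) := by
    have hcoe : ((A ^ θ * K ^ η : ℝ≥0) : ℝ≥0∞) = (A : ℝ≥0∞) ^ θ * (K : ℝ≥0∞) ^ η := by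
      rw [ENNReal.coe_mul, ENNReal.coe_rpow_of_nonneg _ hθ0.le, ENNReal.coe_rpow_of_nonneg _ hη0]
    have hcancel : ∀ (c : Fin n → ℝ) (r : ℝ), 0 < r → (∫⁻ y, F y ∂(cubeAvg c r)) ^ θ *
        (A * (∫⁻ y, F y ∂(cubeAvg c r))⁻¹) ^ θ = (A : ℝ≥0∞) ^ θ := by
      intro c r hr
      rw [← ENNReal.mul_rpow_of_nonneg _ _ hθ0.le, mul_left_comm, ENNReal.mul_inv_cancel
        (lintegral_cubeAvg_ne_zero hF.aemeasurable hF.ne_zero c hr) (hF.lintegral_ne_top c hr),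
        mul_one]
    rw [hcoe]
    rcases hp.eq_or_lt with rfl | hp'
    · have hη1 : η = 0 := by rw [hη]; simp
      rw [apConst_one_le_iff]
      intro c r hr
      have h1 : essSup (fun x => (u x)⁻¹) (volume.restrict (cube c r)) ≤
          (A * (∫⁻ y, F y ∂(cubeAvg c r))⁻¹) ^ θ := by
        refine essSup_le_of_ae_le _ ?_
        filter_upwards [huinv c r hr] with x hx
        rwa [hη1, ENNReal.rpow_zero, mul_one] at hx
      have h2 := havg c r hr
      rw [hη1, ENNReal.rpow_zero, mul_one] at h2
      rw [hη1, ENNReal.rpow_zero, mul_one, ← hcancel c r hr]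
      exact mul_le_mul' h2 h1
    · have hp1 : 0 < p - 1 := by linarith
      rw [apConst_le_iff hp'.ne']
      intro c r hr
      set a := ∫⁻ y, F y ∂(cubeAvg c r) with ha
      have hac := cubeAvg_absolutelyContinuous c r
      have hdual : (∫⁻ x, u x ^ (-1 / (p - 1)) ∂(cubeAvg c r)) ^ (p - 1) ≤
          (A * a⁻¹) ^ θ * ((∫⁻ x, w x ^ (-1 / (q - 1)) ∂(cubeAvg c r)) ^ (q - 1)) ^ η := by
        have h1 : ∫⁻ x, u x ^ (-1 / (p - 1)) ∂(cubeAvg c r) ≤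
            ((A * a⁻¹) ^ θ) ^ (1 / (p - 1)) * ∫⁻ x, w x ^ (-1 / (q - 1)) ∂(cubeAvg c r) := by
          rw [← lintegral_const_mul'' _ ((hw.aemeasurable.mono_ac hac).pow_const _)]
          refine lintegral_mono_ae ?_
          filter_upwards [(cubeAvg_absolutelyContinuous_restrict c r).ae_le (huinv c r hr)]
            with x hx
          have e1 : u x ^ (-1 / (p - 1)) = ((u x)⁻¹) ^ (1 / (p - 1)) := by
            rw [ENNReal.inv_rpow, ← ENNReal.rpow_neg, neg_div]
          have e2 : w x ^ (-1 / (q - 1)) = ((w x)⁻¹ ^ η) ^ (1 / (p - 1)) := by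
            rw [← ENNReal.rpow_mul, ENNReal.inv_rpow, ← ENNReal.rpow_neg]
            congr 1
            rw [hη]
            field_simp
          rw [e1, e2, ← ENNReal.mul_rpow_of_nonneg _ _ (by positivity)]
          exact ENNReal.rpow_le_rpow hx (by positivity)
        calc _ ≤ (((A * a⁻¹) ^ θ) ^ (1 / (p - 1)) *
              ∫⁻ x, w x ^ (-1 / (q - 1)) ∂(cubeAvg c r)) ^ (p - 1) :=
              ENNReal.rpow_le_rpow h1 hp1.le
          _ = _ := by
              rw [ENNReal.mul_rpow_of_nonneg _ _ hp1.le, ← ENNReal.rpow_mul, ← ENNReal.rpow_mul,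
                one_div_mul_cancel hp1.ne', mul_one, ← ENNReal.rpow_mul]
              congr 2
              rw [hη]
              field_simp
      calc _ ≤ (a ^ θ * (∫⁻ x, w x ∂(cubeAvg c r)) ^ η) * ((A * a⁻¹) ^ θ *
            ((∫⁻ x, w x ^ (-1 / (q - 1)) ∂(cubeAvg c r)) ^ (q - 1)) ^ η) :=
            mul_le_mul' (havg c r hr) hdual
        _ = (a ^ θ * (A * a⁻¹) ^ θ) * ((∫⁻ x, w x ∂(cubeAvg c r)) *
            (∫⁻ x, w x ^ (-1 / (q - 1)) ∂(cubeAvg c r)) ^ (q - 1)) ^ η := by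
            rw [ENNReal.mul_rpow_of_nonneg _ _ hη0]
            ring
        _ ≤ A ^ θ * K ^ η := by
            rw [hcancel c r hr]
            gcongr
            exact hK c r hr
  refine ⟨⟨⟨hum, ?_, fun c r hr => ?_⟩, hconst.trans_lt ENNReal.coe_lt_top⟩, hconst⟩
  · filter_upwards [hu0] with x hx using pos_iff_ne_zero.2 hx
  · refine setLIntegral_lt_top_of_cubeAvg c hr ((havg c r hr).trans_lt ?_).ne
    exact ENNReal.mul_lt_top
      (ENNReal.rpow_lt_top_of_nonneg hθ0.le (hF.lintegral_ne_top c hr))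
      (ENNReal.rpow_lt_top_of_nonneg hη0
        (lintegral_cubeAvg_ne_top c hr (hw.locallyIntegrable c r hr)))

/-- `LocallyBdd` restricts a function only at positive arguments, so the Muckenhoupt constants
inserted there must not vanish. -/
lemma apConst_pos {p : ℝ} (hp : 1 ≤ p) {w : (Fin n → ℝ) → ℝ≥0∞} (hw : IsWeight w) :
    0 < apConst p w := by
  have hw0 := isWeight_ne_zero hw
  have hwt := isWeight_ne_top hw
  rw [pos_iff_ne_zero]
  intro h
  have hav := lintegral_cubeAvg_ne_zero hw.aemeasurable hw0 (0 : Fin n → ℝ) one_pos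
  rcases hp.eq_or_lt with rfl | hp'
  · have h1 := apConst_one_le_iff.1 h.le 0 1 one_pos
    rw [nonpos_iff_eq_zero, mul_eq_zero] at h1
    have h2 := h1.resolve_left hav
    rw [ENNReal.essSup_eq_zero_iff] at h2
    have h3 : ∀ᵐ x ∂(volume.restrict (cube (0 : Fin n → ℝ) 1)), False := by
      filter_upwards [h2, ae_restrict_of_ae hwt] with x hx hwt
      exact hwt (ENNReal.inv_eq_zero.1 hx)
    rw [ae_iff] at h3
    simp only [not_false_eq_true, Set.ofPred_true, Measure.restrict_apply_univ] at h3
    exact volume_cube_ne_zero _ one_pos h3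
  · have hp1 : 0 < p - 1 := by linarith
    have h1 := (apConst_le_iff hp'.ne').1 h.le 0 1 one_pos
    rw [nonpos_iff_eq_zero, mul_eq_zero] at h1
    have h2 := h1.resolve_left hav
    rw [ENNReal.rpow_eq_zero_iff_of_pos hp1] at h2
    refine lintegral_cubeAvg_ne_zero (hw.aemeasurable.pow_const _) ?_ 0 one_pos h2
    filter_upwards [hw0, hwt] with x h0 ht
    exact (ENNReal.rpow_pos (pos_iff_ne_zero.2 h0) ht).ne'

end Weights

/-! ### Off-diagonal extrapolation in one variable -/

section OneVariable

variable {n : ℕ}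

lemma exists_memAp_mul_rpow (n : ℕ) {q p : ℝ} (hq : 1 < q) (hqp : q < p) (K : ℝ≥0) :
    ∃ A : ℝ≥0, ∀ w : (Fin n → ℝ) → ℝ≥0∞, IsWeight w → apConst q w ≤ K →
      ∀ f : (Fin n → ℝ) → ℝ≥0∞, AEMeasurable f volume →
        ∫⁻ x, f x ^ q * w x ≠ 0 → ∫⁻ x, f x ^ q * w x ≠ ∞ →
        ∃ F : (Fin n → ℝ) → ℝ≥0∞, AEMeasurable F volume ∧ (∀ᵐ x, F x ≠ 0) ∧ (∀ᵐ x, F x ≠ ∞) ∧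
          (∀ x, f x ≤ F x) ∧ ∫⁻ x, F x ^ q * w x ≤ 2 ^ q * ∫⁻ x, f x ^ q * w x ∧
          MemAp p (fun x => w x * F x ^ (q - p)) ∧ apConst p (fun x => w x * F x ^ (q - p)) ≤ A := by
  obtain ⟨C, hC⟩ := exists_weighted_hlMax_bound n hq K
  refine ⟨K * (3 ^ n * (2 * (C + 1))) ^ (p - q), fun w hw hK f hf hf0 hft => ?_⟩
  obtain ⟨F, hF, hfF, hFI⟩ := exists_isA1Function_majorant hq.le hw.aemeasurable
    (isWeight_ne_zero hw) (hC w _ hw.aemeasurable (isWeight_ne_zero hw) (isWeight_ne_top hw)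
      (Filter.Eventually.of_forall fun x => rfl) (hw.aemeasurable.pow_const _)
      ((apConst_le_iff hq.ne').1 hK)) hf hf0 hft
  obtain ⟨h1, h2⟩ := memAp_mul_rpow_of_lt hq hqp hw hK hF
  exact ⟨F, hF.aemeasurable, hF.ne_zero, hF.ne_top, hfF, hFI, h1, h2⟩

/-- The algorithm runs in `L^{q'}(σ)` with `q' = q/(q-1)` and `σ = w^{-1/(q-1)}`. This works because
`σ ∈ A_{q'}` with constant at most `K^{1/(q-1)}`, the dual weight of `σ` being `w` itself. -/
lemma exists_memAp_rpow_mul_rpow (n : ℕ) {q p : ℝ} (hp : 1 ≤ p) (hpq : p < q) (K : ℝ≥0) :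
    ∃ A : ℝ≥0, ∀ w : (Fin n → ℝ) → ℝ≥0∞, IsWeight w → apConst q w ≤ K →
      ∀ f : (Fin n → ℝ) → ℝ≥0∞, AEMeasurable f volume →
        ∫⁻ x, f x ^ (q / (q - 1)) * w x ^ (-1 / (q - 1)) ≠ 0 →
        ∫⁻ x, f x ^ (q / (q - 1)) * w x ^ (-1 / (q - 1)) ≠ ∞ →
        ∃ F : (Fin n → ℝ) → ℝ≥0∞, AEMeasurable F volume ∧ (∀ᵐ x, F x ≠ 0) ∧ (∀ᵐ x, F x ≠ ∞) ∧
          (∀ x, f x ≤ F x) ∧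
          ∫⁻ x, F x ^ (q / (q - 1)) * w x ^ (-1 / (q - 1)) ≤
            2 ^ (q / (q - 1)) * ∫⁻ x, f x ^ (q / (q - 1)) * w x ^ (-1 / (q - 1)) ∧
          MemAp p (fun x => F x ^ ((q - p) / (q - 1)) * w x ^ ((p - 1) / (q - 1))) ∧
          apConst p (fun x => F x ^ ((q - p) / (q - 1)) * w x ^ ((p - 1) / (q - 1))) ≤ A := by
  have hq1 : 0 < q - 1 := by linarith
  have hq' : 1 < q / (q - 1) := by rw [lt_div_iff₀ hq1]; linarith
  have hq'1 : q / (q - 1) - 1 = 1 / (q - 1) := by field_simp; ring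
  obtain ⟨C, hC⟩ := exists_weighted_hlMax_bound n hq' (K ^ (1 / (q - 1)))
  refine ⟨(3 ^ n * (2 * (C + 1))) ^ ((q - p) / (q - 1)) * K ^ ((p - 1) / (q - 1)),
    fun w hw hK f hf hf0 hft => ?_⟩
  have hw0 := isWeight_ne_zero hw
  have hwt := isWeight_ne_top hw
  have hσ0 : ∀ᵐ x, w x ^ (-1 / (q - 1)) ≠ 0 := by
    filter_upwards [hw0, hwt] with x h0 ht
    exact (ENNReal.rpow_pos (pos_iff_ne_zero.2 h0) ht).ne'
  have hσt : ∀ᵐ x, w x ^ (-1 / (q - 1)) ≠ ∞ := by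
    filter_upwards [hw0, hwt] with x h0 ht using ENNReal.rpow_ne_top_of_ne_zero h0 ht
  have hK' := (apConst_le_iff (by linarith : q ≠ 1)).1 hK
  obtain ⟨F, hF, hfF, hFI⟩ := exists_isA1Function_majorant hq'.le
    (hw.aemeasurable.pow_const (-1 / (q - 1))) hσ0
    (hC (fun x => w x ^ (-1 / (q - 1))) w (hw.aemeasurable.pow_const _) hσ0 hσt
      (Filter.Eventually.of_forall fun x => by
        rw [hq'1, ← ENNReal.rpow_mul]
        conv_lhs => rw [← ENNReal.rpow_one (w x)]
        congr 1
        field_simp) hw.aemeasurable (fun c r hr => by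
        rw [hq'1, ENNReal.coe_rpow_of_nonneg _ (by positivity)]
        refine le_trans (le_of_eq ?_) (ENNReal.rpow_le_rpow (hK' c r hr)
          (by positivity : 0 ≤ 1 / (q - 1)))
        rw [ENNReal.mul_rpow_of_nonneg _ _ (by positivity), ← ENNReal.rpow_mul,
          mul_one_div_cancel hq1.ne', ENNReal.rpow_one, mul_comm]
        rfl)) hf hf0 hft
  obtain ⟨h1, h2⟩ := memAp_rpow_mul_rpow_of_lt hp hpq hw hK hF
  exact ⟨F, hF.aemeasurable, hF.ne_zero, hF.ne_top, hfF, hFI, h1, h2⟩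

/-- One-variable off-diagonal extrapolation from `(p₀, p)` to `(q₀, q)`: an estimate for the pair
`(H, f)` for all `A_{p₀}` weights with controlled constant implies one for an `A_{q₀}` weight. -/
def ExtrapolatesTo (n : ℕ) (p₀ p q₀ q : ℝ) : Prop :=
  ∀ K : ℝ≥0, ∃ A D : ℝ≥0, ∀ w : (Fin n → ℝ) → ℝ≥0∞, MemAp q₀ w → apConst q₀ w ≤ K →
    ∀ f : (Fin n → ℝ) → ℝ≥0∞, AEMeasurable f volume → ∫⁻ x, f x ^ q₀ * w x ≠ ∞ →
      (∃ u : (Fin n → ℝ) → ℝ≥0∞, MemAp p₀ u ∧ apConst p₀ u ≤ A ∧ ∫⁻ x, f x ^ p₀ * u x ≠ ∞) ∧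
      ∀ (H : (Fin n → ℝ) → ℝ≥0∞) (C : ℝ≥0∞), AEMeasurable H volume → (∀ᵐ x, H x ≠ ∞) →
        (∀ u : (Fin n → ℝ) → ℝ≥0∞, MemAp p₀ u → apConst p₀ u ≤ A → ∫⁻ x, f x ^ p₀ * u x ≠ ∞ →
          (∫⁻ x, H x ^ p * u x ^ (p / p₀)) ^ (1 / p) ≤
            C * (∫⁻ x, f x ^ p₀ * u x) ^ (1 / p₀)) →
        (∫⁻ x, H x ^ q * w x ^ (q / q₀)) ^ (1 / q) ≤
          D * C * (∫⁻ x, f x ^ q₀ * w x) ^ (1 / q₀)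

/-- Hölder's inequality behind downward extrapolation. -/
lemma lintegral_rpow_le_of_majorant {p₀ p q₀ q : ℝ} (hq₀ : 0 < q₀) (hqp₀ : q₀ < p₀)
    (hq : 0 < q) (hp : 0 < p) (h : 1 / p - 1 / p₀ = 1 / q - 1 / q₀)
    {w F H : (Fin n → ℝ) → ℝ≥0∞} (hw : AEMeasurable w volume) (hw0 : ∀ᵐ x, w x ≠ 0)
    (hwt : ∀ᵐ x, w x ≠ ∞) (hF : AEMeasurable F volume) (hF0 : ∀ᵐ x, F x ≠ 0)
    (hFt : ∀ᵐ x, F x ≠ ∞) (hH : AEMeasurable H volume) :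
    (∫⁻ x, H x ^ q * w x ^ (q / q₀)) ^ (1 / q) ≤
      (∫⁻ x, H x ^ p * (w x * F x ^ (q₀ - p₀)) ^ (p / p₀)) ^ (1 / p) *
        (∫⁻ x, F x ^ q₀ * w x) ^ (1 / q₀ - 1 / p₀) := by
  have hp₀ : 0 < p₀ := by linarith
  have he : 0 < 1 / q₀ - 1 / p₀ := sub_pos.2 (one_div_lt_one_div_of_lt hq₀ hqp₀)
  have hα : 0 ≤ q / p := by positivity
  have hβ : 1 - q / p = q * (1 / q₀ - 1 / p₀) := by
    have : 1 / q₀ - 1 / p₀ = 1 / q - 1 / p := by linarith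
    rw [this]
    field_simp
  have hβ0 : 0 ≤ 1 - q / p := by rw [hβ]; positivity
  have hum : AEMeasurable (fun x => H x ^ p * (w x * F x ^ (q₀ - p₀)) ^ (p / p₀)) volume :=
    (hH.pow_const _).mul ((hw.mul (hF.pow_const _)).pow_const _)
  have hGm : AEMeasurable (fun x => F x ^ q₀ * w x) volume := (hF.pow_const _).mul hw
  -- Hölder with exponents `q/p` and `1 - q/p`; by `h` the powers of `F` cancel and those of `w` add
  -- up to `q/q₀`.
  have key : ∫⁻ x, H x ^ q * w x ^ (q / q₀) ≤
      (∫⁻ x, H x ^ p * (w x * F x ^ (q₀ - p₀)) ^ (p / p₀)) ^ (q / p) *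
        (∫⁻ x, F x ^ q₀ * w x) ^ (1 - q / p) := by
    refine le_trans (le_of_eq ?_) (ENNReal.lintegral_mul_norm_pow_le hum hGm hα hβ0 (by ring))
    refine lintegral_congr_ae ?_
    filter_upwards [hw0, hwt, hF0, hFt] with x hw0 hwt hF0 hFt
    have hFr := ENNReal.rpow_ne_top_of_ne_zero (y := q₀ - p₀) hF0 hFt
    rw [ENNReal.mul_rpow_of_nonneg _ _ hα, ENNReal.mul_rpow_of_nonneg _ _ hβ0,
      ENNReal.mul_rpow_of_ne_top hwt hFr, ENNReal.mul_rpow_of_nonneg _ _ hα]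
    simp only [← ENNReal.rpow_mul]
    calc H x ^ q * w x ^ (q / q₀)
        = H x ^ (p * (q / p)) * (w x ^ (p / p₀ * (q / p) + (1 - q / p)) *
          F x ^ ((q₀ - p₀) * (p / p₀ * (q / p)) + q₀ * (1 - q / p))) := by
          have e1 : p * (q / p) = q := by field_simp
          have e2 : p / p₀ * (q / p) + (1 - q / p) = q / q₀ := by
            rw [hβ]; field_simp; ring
          have e3 : (q₀ - p₀) * (p / p₀ * (q / p)) + q₀ * (1 - q / p) = 0 := by
            rw [hβ]; field_simp; ring
          rw [e1, e2, e3, ENNReal.rpow_zero, mul_one]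
      _ = _ := by
          rw [ENNReal.rpow_add _ _ hw0 hwt, ENNReal.rpow_add _ _ hF0 hFt,
            mul_assoc (q₀ - p₀) (p / p₀) (q / p)]
          ring
  calc _ ≤ ((∫⁻ x, H x ^ p * (w x * F x ^ (q₀ - p₀)) ^ (p / p₀)) ^ (q / p) *
        (∫⁻ x, F x ^ q₀ * w x) ^ (1 - q / p)) ^ (1 / q) :=
        ENNReal.rpow_le_rpow key (by positivity)
    _ = _ := by
        rw [ENNReal.mul_rpow_of_nonneg _ _ (by positivity), ← ENNReal.rpow_mul, ← ENNReal.rpow_mul,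
          hβ]
        congr 2 <;> field_simp

lemma lintegral_indicator_cube_ne {w : (Fin n → ℝ) → ℝ≥0∞} (hw : IsWeight w) {q : ℝ}
    (hq : 0 < q) :
    ∫⁻ x, (cube (0 : Fin n → ℝ) 1).indicator 1 x ^ q * w x ≠ 0 ∧
      ∫⁻ x, (cube (0 : Fin n → ℝ) 1).indicator 1 x ^ q * w x ≠ ∞ := by
  have : ∫⁻ x, (cube (0 : Fin n → ℝ) 1).indicator 1 x ^ q * w x =
      ∫⁻ x in cube (0 : Fin n → ℝ) 1, w x := by
    rw [← lintegral_indicator (measurableSet_cube _ _)]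
    refine lintegral_congr fun x => ?_
    by_cases hx : x ∈ cube (0 : Fin n → ℝ) 1 <;> simp [hx, hq]
  rw [this]
  refine ⟨?_, (hw.locallyIntegrable 0 1 one_pos).ne⟩
  rw [← withDensity_apply']
  exact withDensity_apply_ne_zero hw.aemeasurable (isWeight_ne_zero hw)
    (volume_cube_ne_zero 0 one_pos)

/-- With `u = w F^{q₀-p₀}` and `f ≤ F`, the integral of `f^{p₀} u` is at most that of `f^{q₀} w`.
The loss in passing from `u` back to `w` is a power of the integral of `F^{q₀} w`, which the
algorithm controls. -/
lemma extrapolatesTo_of_lt (n : ℕ) {p₀ p q₀ q : ℝ} (hq₀ : 1 < q₀) (hqp₀ : q₀ < p₀)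
    (hq : 0 < q) (hp : 0 < p) (h : 1 / p - 1 / p₀ = 1 / q - 1 / q₀) :
    ExtrapolatesTo n p₀ p q₀ q := by
  intro K
  obtain ⟨A, hA⟩ := exists_memAp_mul_rpow n hq₀ hqp₀ K
  have hq₀0 : 0 < q₀ := by linarith
  have hp₀0 : 0 < p₀ := by linarith
  have he : 0 < 1 / q₀ - 1 / p₀ := sub_pos.2 (one_div_lt_one_div_of_lt hq₀0 hqp₀)
  refine ⟨A, (2 ^ q₀) ^ (1 / q₀ - 1 / p₀), fun w hw hK f hf hft => ?_⟩
  have hw0 := isWeight_ne_zero hw.1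
  have hwt := isWeight_ne_top hw.1
  -- The algorithm needs a nonzero input. If `f = 0` almost everywhere, the indicator of a cube
  -- replaces it, and the hypothesis on the resulting weight makes the norm of `H` vanish.
  by_cases hf0 : ∫⁻ x, f x ^ q₀ * w x = 0
  · have hfz : ∀ᵐ x, f x = 0 := by
      have hm : AEMeasurable (fun x => f x ^ q₀ * w x) volume :=
        (hf.pow_const _).mul hw.1.aemeasurable
      rw [lintegral_eq_zero_iff' hm] at hf0
      filter_upwards [hf0, hw0] with x hx hw0
      have := (mul_eq_zero.1 hx).resolve_right hw0
      rwa [ENNReal.rpow_eq_zero_iff_of_pos hq₀0] at this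
    obtain ⟨g0, gt⟩ := lintegral_indicator_cube_ne hw.1 hq₀0
    obtain ⟨F, hF, hF0, hFt, -, hFI, hu, huA⟩ := hA w hw.1 hK _
      ((measurable_one.indicator (measurableSet_cube 0 1)).aemeasurable) g0 gt
    have hz : ∫⁻ x, f x ^ p₀ * (w x * F x ^ (q₀ - p₀)) = 0 := by
      rw [lintegral_congr_ae (g := 0), Pi.zero_def, lintegral_zero]
      filter_upwards [hfz] with x hx
      simp [hx, hp₀0]
    refine ⟨⟨_, hu, huA, by simp [hz]⟩, fun H C hH _ hyp => ?_⟩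
    refine (lintegral_rpow_le_of_majorant hq₀0 hqp₀ hq hp h hw.1.aemeasurable hw0 hwt
      hF hF0 hFt hH).trans ?_
    have h1 := hyp _ hu huA (by simp [hz])
    rw [hz, ENNReal.zero_rpow_of_pos (by positivity), mul_zero] at h1
    rw [nonpos_iff_eq_zero.1 h1, zero_mul]
    exact bot_le
  · obtain ⟨F, hF, hF0, hFt, hfF, hFI, hu, huA⟩ := hA w hw.1 hK f hf hf0 hft
    have hle : ∫⁻ x, f x ^ p₀ * (w x * F x ^ (q₀ - p₀)) ≤ ∫⁻ x, f x ^ q₀ * w x := by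
      refine lintegral_mono fun x => ?_
      have e1 : f x ^ p₀ = f x ^ q₀ * f x ^ (p₀ - q₀) := by
        rw [← ENNReal.rpow_add_of_nonneg _ _ hq₀0.le (by linarith)]
        congr 1
        ring
      have e2 : F x ^ (q₀ - p₀) ≤ (f x ^ (p₀ - q₀))⁻¹ := by
        rw [← neg_sub, ENNReal.rpow_neg]
        exact ENNReal.inv_le_inv.2 (ENNReal.rpow_le_rpow (hfF x) (by linarith))
      calc f x ^ p₀ * (w x * F x ^ (q₀ - p₀))
          ≤ f x ^ q₀ * f x ^ (p₀ - q₀) * (w x * (f x ^ (p₀ - q₀))⁻¹) := by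
            rw [e1]
            gcongr
        _ = f x ^ q₀ * w x * (f x ^ (p₀ - q₀) * (f x ^ (p₀ - q₀))⁻¹) := by ring
        _ ≤ f x ^ q₀ * w x * 1 := by
            gcongr
            exact ENNReal.mul_inv_le_one _
        _ = _ := mul_one _
    have hut := (hle.trans_lt hft.lt_top).ne
    refine ⟨⟨_, hu, huA, hut⟩, fun H C hH _ hyp => ?_⟩
    refine (lintegral_rpow_le_of_majorant hq₀0 hqp₀ hq hp h hw.1.aemeasurable hw0 hwt
      hF hF0 hFt hH).trans ?_
    set N := ∫⁻ x, f x ^ q₀ * w x with hN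
    calc _ ≤ (C * N ^ (1 / p₀)) * (2 ^ q₀ * N) ^ (1 / q₀ - 1 / p₀) := by
          gcongr
          refine (hyp _ hu huA hut).trans ?_
          gcongr
      _ = (2 ^ q₀) ^ (1 / q₀ - 1 / p₀) * C * (N ^ (1 / p₀) * N ^ (1 / q₀ - 1 / p₀)) := by
          rw [ENNReal.mul_rpow_of_nonneg _ _ he.le]
          ring
      _ = _ := by
          rw [← ENNReal.rpow_add_of_nonneg _ _ (by positivity) he.le, add_sub_cancel,
            ENNReal.coe_rpow_of_nonneg _ he.le, ENNReal.coe_rpow_of_nonneg _ hq₀0.le]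
          rfl

/-- The weights used in upward extrapolation. -/
lemma exists_memAp_ge (n : ℕ) {p₀ q₀ : ℝ} (hp₀ : 1 ≤ p₀) (hpq₀ : p₀ < q₀) (K : ℝ≥0) :
    ∃ A : ℝ≥0, ∀ w : (Fin n → ℝ) → ℝ≥0∞, IsWeight w → apConst q₀ w ≤ K →
      ∀ k : (Fin n → ℝ) → ℝ≥0∞, AEMeasurable k volume → ∫⁻ x, k x ≠ 0 → ∫⁻ x, k x ≠ ∞ →
        ∃ u : (Fin n → ℝ) → ℝ≥0∞, MemAp p₀ u ∧ apConst p₀ u ≤ A ∧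
          (∀ᵐ x, k x ^ (1 - p₀ / q₀) * w x ^ (p₀ / q₀) ≤ u x) ∧
          ∀ f : (Fin n → ℝ) → ℝ≥0∞, AEMeasurable f volume → ∫⁻ x, f x ^ p₀ * u x ≤
            (∫⁻ x, f x ^ q₀ * w x) ^ (p₀ / q₀) *
              (2 ^ (q₀ / (q₀ - 1)) * ∫⁻ x, k x) ^ (1 - p₀ / q₀) := by
  have hq₀ : 0 < q₀ := by linarith
  have hq₀1 : 0 < q₀ - 1 := by linarith
  have hp₀0 : 0 < p₀ := by linarith
  have hβ : 0 < 1 - p₀ / q₀ := by rw [sub_pos, div_lt_one hq₀]; exact hpq₀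
  have hθ : 0 ≤ (q₀ - p₀) / (q₀ - 1) := div_nonneg (by linarith) hq₀1.le
  obtain ⟨A, hA⟩ := exists_memAp_rpow_mul_rpow n hp₀ hpq₀ K
  refine ⟨A, fun w hw hK k hk hk0 hkt => ?_⟩
  have hw0 := isWeight_ne_zero hw
  have hwt := isWeight_ne_top hw
  -- The function fed to the algorithm is scaled so that its norm in the dual weighted space is
  -- governed by the integral of `k` alone.
  have hφ : ∫⁻ x, (k x ^ ((q₀ - 1) / q₀) * w x ^ (1 / q₀)) ^ (q₀ / (q₀ - 1)) *
      w x ^ (-1 / (q₀ - 1)) = ∫⁻ x, k x := by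
    refine lintegral_congr_ae ?_
    filter_upwards [hw0, hwt] with x hw0 hwt
    rw [ENNReal.mul_rpow_of_nonneg _ _ (by positivity), ← ENNReal.rpow_mul, ← ENNReal.rpow_mul,
      mul_assoc, ← ENNReal.rpow_add _ _ hw0 hwt]
    have e1 : (q₀ - 1) / q₀ * (q₀ / (q₀ - 1)) = 1 := by field_simp
    have e2 : 1 / q₀ * (q₀ / (q₀ - 1)) + -1 / (q₀ - 1) = 0 := by field_simp; ring
    rw [e1, e2, ENNReal.rpow_one, ENNReal.rpow_zero, mul_one]
  obtain ⟨F, hF, hF0, hFt, hfF, hFI, hu, huA⟩ := hA w hw hK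
    (fun x => k x ^ ((q₀ - 1) / q₀) * w x ^ (1 / q₀))
    ((hk.pow_const _).mul (hw.aemeasurable.pow_const _)) (by rwa [hφ]) (by rwa [hφ])
  rw [hφ] at hFI
  refine ⟨_, hu, huA, ?_, fun f hf => ?_⟩
  · filter_upwards [hw0, hwt] with x hw0 hwt
    refine le_trans (le_of_eq ?_) (mul_le_mul_left (ENNReal.rpow_le_rpow (hfF x) hθ) _)
    rw [ENNReal.mul_rpow_of_nonneg _ _ hθ, ← ENNReal.rpow_mul, ← ENNReal.rpow_mul,
      mul_assoc, ← ENNReal.rpow_add _ _ hw0 hwt]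
    congr 2
    · field_simp
    · field_simp
      ring
  · calc _ = ∫⁻ x, (f x ^ q₀ * w x) ^ (p₀ / q₀) *
          (F x ^ (q₀ / (q₀ - 1)) * w x ^ (-1 / (q₀ - 1))) ^ (1 - p₀ / q₀) := by
          refine lintegral_congr_ae ?_
          filter_upwards [hw0, hwt] with x hw0 hwt
          rw [ENNReal.mul_rpow_of_nonneg _ _ (by positivity), ENNReal.mul_rpow_of_nonneg _ _ hβ.le]
          simp only [← ENNReal.rpow_mul]
          calc f x ^ p₀ * (F x ^ ((q₀ - p₀) / (q₀ - 1)) * w x ^ ((p₀ - 1) / (q₀ - 1)))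
              = f x ^ (q₀ * (p₀ / q₀)) * (F x ^ (q₀ / (q₀ - 1) * (1 - p₀ / q₀)) *
                w x ^ (p₀ / q₀ + -1 / (q₀ - 1) * (1 - p₀ / q₀))) := by
                congr 3
                · field_simp
                · field_simp
                · field_simp
                  ring
            _ = _ := by
                rw [ENNReal.rpow_add _ _ hw0 hwt]
                ring
      _ ≤ (∫⁻ x, f x ^ q₀ * w x) ^ (p₀ / q₀) *
          (∫⁻ x, F x ^ (q₀ / (q₀ - 1)) * w x ^ (-1 / (q₀ - 1))) ^ (1 - p₀ / q₀) :=
          ENNReal.lintegral_mul_norm_pow_le ((hf.pow_const _).mul hw.aemeasurable)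
            ((hF.pow_const _).mul (hw.aemeasurable.pow_const _)) (by positivity) hβ.le (by ring)
      _ ≤ _ := by gcongr

/-- The weight is built from `k`, essentially the integrand `H^q w^{q/q₀}` itself, so no duality in
`L^q` is needed and `q < 1` is allowed. With `J` the integral of `k`, the hypothesis yields `J^{1/p}
≤ B J^{1/p₀-1/q₀}`, and division leaves `J^{1/q} ≤ B`. -/
lemma extrapolatesTo_of_gt (n : ℕ) {p₀ p q₀ q : ℝ} (hp₀ : 1 ≤ p₀) (hpq₀ : p₀ < q₀)
    (hq : 0 < q) (hp : 0 < p) (h : 1 / p - 1 / p₀ = 1 / q - 1 / q₀) :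
    ExtrapolatesTo n p₀ p q₀ q := by
  intro K
  obtain ⟨A, hA⟩ := exists_memAp_ge n hp₀ hpq₀ K
  have hp₀0 : 0 < p₀ := by linarith
  have hq₀0 : 0 < q₀ := by linarith
  have hq₀1 : 0 < q₀ - 1 := by linarith
  have he : 0 < 1 / p₀ - 1 / q₀ := sub_pos.2 (one_div_lt_one_div_of_lt hp₀0 hpq₀)
  have hβ : 0 < 1 - p₀ / q₀ := by rw [sub_pos, div_lt_one hq₀0]; exact hpq₀
  refine ⟨A, (2 ^ (q₀ / (q₀ - 1))) ^ (1 / p₀ - 1 / q₀), fun w hw hK f hf hft => ?_⟩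
  have hw0 := isWeight_ne_zero hw.1
  have hwt := isWeight_ne_top hw.1
  have hfin : ∀ k : (Fin n → ℝ) → ℝ≥0∞, ∫⁻ x, k x ≠ ∞ →
      (∫⁻ x, f x ^ q₀ * w x) ^ (p₀ / q₀) *
        (2 ^ (q₀ / (q₀ - 1)) * ∫⁻ x, k x) ^ (1 - p₀ / q₀) ≠ ∞ := fun k hk =>
    ENNReal.mul_ne_top (ENNReal.rpow_ne_top_of_nonneg (by positivity) hft)
      (ENNReal.rpow_ne_top_of_nonneg hβ.le (ENNReal.mul_ne_top
        (ENNReal.rpow_ne_top_of_nonneg (by positivity) (by simp)) hk))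
  constructor
  · have hind : ∫⁻ x, (cube (0 : Fin n → ℝ) 1).indicator 1 x = volume (cube (0 : Fin n → ℝ) 1) :=
      lintegral_indicator_one (measurableSet_cube _ _)
    have hk0 : ∫⁻ x, (cube (0 : Fin n → ℝ) 1).indicator (1 : (Fin n → ℝ) → ℝ≥0∞) x ≠ 0 := by
      rw [hind]
      exact volume_cube_ne_zero 0 one_pos
    have hkt : ∫⁻ x, (cube (0 : Fin n → ℝ) 1).indicator (1 : (Fin n → ℝ) → ℝ≥0∞) x ≠ ∞ := by
      rw [hind]
      exact volume_cube_ne_top 0 one_pos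
    obtain ⟨u, hu, huA, -, huf⟩ := hA w hw.1 hK _
      ((measurable_one.indicator (measurableSet_cube 0 1)).aemeasurable) hk0 hkt
    exact ⟨u, hu, huA, ((huf f hf).trans_lt (hfin _ hkt).lt_top).ne⟩
  · intro H C hH hHt hyp
    set N := ∫⁻ x, f x ^ q₀ * w x with hN
    set B : ℝ≥0∞ := ((2 ^ (q₀ / (q₀ - 1))) ^ (1 / p₀ - 1 / q₀) : ℝ≥0) * C * N ^ (1 / q₀) with hB
    suffices hmain : ∫⁻ x, H x ^ q * w x ^ (q / q₀) ≤ B ^ q by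
      calc _ ≤ (B ^ q) ^ (1 / q) := ENNReal.rpow_le_rpow hmain (by positivity)
        _ = B := by rw [← ENNReal.rpow_mul, mul_one_div_cancel hq.ne', ENNReal.rpow_one]
    refine le_of_forall_lt fun J hJ => ?_
    -- Division by a power of `J` requires `0 < J < ∞`, so the integrand is replaced by a simple
    -- function `g` below it. The approximation theorem takes `ℝ≥0`-valued functions, hence the
    -- finiteness assumed of `H`.
    have hlift : ∫⁻ x, H x ^ q * w x ^ (q / q₀) =
        ∫⁻ x, ((H x ^ q * w x ^ (q / q₀)).toNNReal : ℝ≥0∞) := by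
      refine lintegral_congr_ae ?_
      filter_upwards [hHt, hw0, hwt] with x hHt hw0 hwt
      rw [ENNReal.coe_toNNReal]
      exact ENNReal.mul_ne_top (ENNReal.rpow_ne_top_of_nonneg hq.le hHt)
        (ENNReal.rpow_ne_top_of_ne_zero hw0 hwt)
    rw [hlift] at hJ
    obtain ⟨g, hgle, hgt, hgJ⟩ := exists_lt_lintegral_simpleFunc_of_lt_lintegral hJ
    refine hgJ.trans_le ?_
    set J' := ∫⁻ x, (g x : ℝ≥0∞) with hJ'
    have hJ0 : J' ≠ 0 := (bot_le.trans_lt hgJ).ne'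
    have hgm : AEMeasurable (fun x => (g x : ℝ≥0∞)) volume :=
      g.measurable.coe_nnreal_ennreal.aemeasurable
    obtain ⟨u, hu, huA, hgu, huf⟩ := hA w hw.1 hK (fun x => (g x : ℝ≥0∞)) hgm hJ0 hgt.ne
    -- The bound for `g` by the integrand is raised to the power `p/q`, the lower bound for `u` to
    -- `p/p₀`; the resulting exponents of `g` add up to `1`.
    have hJH : J' ≤ ∫⁻ x, H x ^ p * u x ^ (p / p₀) := by
      refine lintegral_mono_ae ?_
      filter_upwards [hgu, hw0, hwt] with x hgu hw0 hwt
      have h1 : (g x : ℝ≥0∞) ≤ H x ^ q * w x ^ (q / q₀) :=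
        (ENNReal.coe_le_coe.2 (hgle x)).trans ENNReal.coe_toNNReal_le_self
      have h2 : (g x : ℝ≥0∞) ^ (p / q) ≤ H x ^ p * w x ^ (p / q₀) := by
        refine (ENNReal.rpow_le_rpow h1 (by positivity)).trans (le_of_eq ?_)
        rw [ENNReal.mul_rpow_of_nonneg _ _ (by positivity), ← ENNReal.rpow_mul,
          ← ENNReal.rpow_mul]
        congr 2 <;> field_simp
      have h3 : (g x : ℝ≥0∞) ^ (p * (1 / p₀ - 1 / q₀)) * w x ^ (p / q₀) ≤ u x ^ (p / p₀) := by
        refine le_trans (le_of_eq ?_)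
          (ENNReal.rpow_le_rpow hgu (by positivity : 0 ≤ p / p₀))
        rw [ENNReal.mul_rpow_of_nonneg _ _ (by positivity), ← ENNReal.rpow_mul,
          ← ENNReal.rpow_mul]
        congr 2 <;> field_simp
      have h4 : (g x : ℝ≥0∞) ^ (p / q) * (g x : ℝ≥0∞) ^ (p * (1 / p₀ - 1 / q₀)) = g x := by
        rw [← ENNReal.rpow_add_of_nonneg _ _ (by positivity) (by positivity)]
        have : p / q + p * (1 / p₀ - 1 / q₀) = 1 := by
          have : 1 / p₀ - 1 / q₀ = 1 / p - 1 / q := by linarith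
          rw [this]
          field_simp
          ring
        rw [this, ENNReal.rpow_one]
      have hwp0 : w x ^ (p / q₀) ≠ 0 := (ENNReal.rpow_pos (pos_iff_ne_zero.2 hw0) hwt).ne'
      have hwpt : w x ^ (p / q₀) ≠ ∞ := ENNReal.rpow_ne_top_of_ne_zero hw0 hwt
      calc (g x : ℝ≥0∞) = (g x : ℝ≥0∞) ^ (p / q) * (g x : ℝ≥0∞) ^ (p * (1 / p₀ - 1 / q₀)) := h4.symm
        _ ≤ H x ^ p * w x ^ (p / q₀) * (g x : ℝ≥0∞) ^ (p * (1 / p₀ - 1 / q₀)) := by gcongr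
        _ = H x ^ p * ((g x : ℝ≥0∞) ^ (p * (1 / p₀ - 1 / q₀)) * w x ^ (p / q₀)) := by ring
        _ ≤ _ := by gcongr
    have hchain : J' ^ (1 / p) ≤ B * J' ^ (1 / p₀ - 1 / q₀) := by
      calc J' ^ (1 / p) ≤ (∫⁻ x, H x ^ p * u x ^ (p / p₀)) ^ (1 / p) :=
            ENNReal.rpow_le_rpow hJH (by positivity)
        _ ≤ C * (∫⁻ x, f x ^ p₀ * u x) ^ (1 / p₀) :=
            hyp u hu huA ((huf f hf).trans_lt (hfin _ hgt.ne).lt_top).ne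
        _ ≤ C * (N ^ (p₀ / q₀) * (2 ^ (q₀ / (q₀ - 1)) * J') ^ (1 - p₀ / q₀)) ^ (1 / p₀) := by
            gcongr
            exact huf f hf
        _ = _ := by
            have e1 : p₀ / q₀ * (1 / p₀) = 1 / q₀ := by field_simp
            have e2 : (1 - p₀ / q₀) * (1 / p₀) = 1 / p₀ - 1 / q₀ := by field_simp
            rw [ENNReal.mul_rpow_of_nonneg _ _ (by positivity), ← ENNReal.rpow_mul,
              ← ENNReal.rpow_mul, e1, e2, ENNReal.mul_rpow_of_nonneg _ _ he.le, hB,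
              ENNReal.coe_rpow_of_nonneg _ he.le, ENNReal.coe_rpow_of_nonneg _ (by positivity)]
            push_cast
            ring
    have hJe0 : J' ^ (1 / p₀ - 1 / q₀) ≠ 0 :=
      (ENNReal.rpow_pos (pos_iff_ne_zero.2 hJ0) hgt.ne).ne'
    have hJet : J' ^ (1 / p₀ - 1 / q₀) ≠ ∞ := ENNReal.rpow_ne_top_of_nonneg he.le hgt.ne
    have hsplit : J' ^ (1 / p) = J' ^ (1 / q) * J' ^ (1 / p₀ - 1 / q₀) := by
      rw [← ENNReal.rpow_add_of_nonneg _ _ (by positivity) he.le]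
      congr 1
      linarith
    rw [hsplit, ENNReal.mul_le_mul_iff_left hJe0 hJet] at hchain
    calc J' = (J' ^ (1 / q)) ^ q := by
          rw [← ENNReal.rpow_mul, one_div_mul_cancel hq.ne', ENNReal.rpow_one]
      _ ≤ B ^ q := ENNReal.rpow_le_rpow hchain hq.le

lemma extrapolatesTo (n : ℕ) {p₀ p q₀ q : ℝ} (hp₀ : 1 ≤ p₀) (hq₀ : 1 < q₀)
    (hq : 0 < q) (hp : 0 < p) (h : 1 / p - 1 / p₀ = 1 / q - 1 / q₀) :
    ExtrapolatesTo n p₀ p q₀ q := by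
  rcases lt_trichotomy p₀ q₀ with hlt | rfl | hgt
  · exact extrapolatesTo_of_gt n hp₀ hlt hq hp h
  · have : p = q := by
      have : 1 / p = 1 / q := by linarith
      simpa using this
    subst this
    refine fun K => ⟨K, 1, fun w hw hK f hf hft => ⟨⟨w, hw, hK, hft⟩, fun H C hH _ hyp => ?_⟩⟩
    simpa using hyp w hw hK hft
  · exact extrapolatesTo_of_lt n hq₀ hgt hq hp h

end OneVariable

/-! ### From one variable to the bilinear theorem -/

section Bilinear

variable {n : ℕ} {𝕜 : Type*} [RCLike 𝕜]

/-- `T` is bounded from `L^{p₁}(w₁) × L^{p₂}(w₂)` to weak `L^p`, uniformly over weights whose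
Muckenhoupt constants are at most `M`. -/
def UniformlyWeakBounded (T : ((Fin n → ℝ) → 𝕜) → ((Fin n → ℝ) → 𝕜) → ((Fin n → ℝ) → 𝕜))
    (p₁ p₂ p : ℝ) : Prop :=
  ∀ M : ℝ≥0, ∃ C : ℝ≥0, ∀ w₁ w₂ : (Fin n → ℝ) → ℝ≥0∞, MemAp p₁ w₁ → MemAp p₂ w₂ →
    apConst p₁ w₁ ≤ M → apConst p₂ w₂ ≤ M →
      WeakBoundedWith T p₁ p₂ p w₁ w₂ (fun x => w₁ x ^ (p / p₁) * w₂ x ^ (p / p₂)) C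

lemma UniformlyWeakBounded.swap
    {T : ((Fin n → ℝ) → 𝕜) → ((Fin n → ℝ) → 𝕜) → ((Fin n → ℝ) → 𝕜)} {p₁ p₂ p : ℝ}
    (hT : UniformlyWeakBounded T p₁ p₂ p) :
    UniformlyWeakBounded (fun f g => T g f) p₂ p₁ p := by
  intro M
  obtain ⟨C, hC⟩ := hT M
  refine ⟨C, fun w₁ w₂ hw₁ hw₂ h₁ h₂ f₁ f₂ hf₁ hf₂ => ?_⟩
  have hcomm : (fun x => w₁ x ^ (p / p₂) * w₂ x ^ (p / p₁)) =
      fun x => w₂ x ^ (p / p₁) * w₁ x ^ (p / p₂) := funext fun x => mul_comm _ _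
  obtain ⟨h1, h2⟩ := hC w₂ w₁ hw₂ hw₁ h₂ h₁ f₂ f₁ hf₂ hf₁
  rw [hcomm]
  exact ⟨h1, h2.trans (le_of_eq (by ring))⟩

lemma eLpNorm_withDensity {p : ℝ} (hp : 0 < p) {u : (Fin n → ℝ) → ℝ≥0∞}
    (hu : AEMeasurable u volume) {f : (Fin n → ℝ) → 𝕜} (hf : AEStronglyMeasurable f volume) :
    eLpNorm f (ENNReal.ofReal p) (volume.withDensity u) =
      (∫⁻ x, ‖f x‖ₑ ^ p * u x) ^ (1 / p) := by
  rw [eLpNorm_eq_lintegral_rpow_enorm_toReal (by simpa using hp) ENNReal.ofReal_ne_top,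
    ENNReal.toReal_ofReal hp.le,
    lintegral_withDensity_eq_lintegral_mul₀ hu (hf.enorm.pow_const _)]
  simp [mul_comm]

lemma memLp_withDensity {p : ℝ} (hp : 0 < p) {u : (Fin n → ℝ) → ℝ≥0∞}
    (hu : AEMeasurable u volume) {f : (Fin n → ℝ) → 𝕜} (hf : AEStronglyMeasurable f volume)
    (hfu : ∫⁻ x, ‖f x‖ₑ ^ p * u x ≠ ∞) :
    MemLp f (ENNReal.ofReal p) (volume.withDensity u) := by
  refine ⟨hf.mono_ac (withDensity_absolutelyContinuous _ _), ?_⟩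
  rw [eLpNorm_withDensity hp hu hf]
  exact ENNReal.rpow_lt_top_of_nonneg (by positivity) hfu

/-- A level-set term of the weak norm as a strong norm of a multiple of an indicator function. -/
lemma lintegral_indicator_rpow_mul_rpow {p p₀ r : ℝ} (hp : 0 < p) (y : ℝ≥0) {E : Set (Fin n → ℝ)}
    (hE : NullMeasurableSet E volume) {u v : (Fin n → ℝ) → ℝ≥0∞} (hu : AEMeasurable u volume)
    (hv : AEMeasurable v volume) :
    (∫⁻ x, E.indicator (fun x => (y : ℝ≥0∞) * v x ^ (1 / r)) x ^ p * u x ^ (p / p₀)) ^ (1 / p) =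
      y * volume.withDensity (fun x => u x ^ (p / p₀) * v x ^ (p / r)) E ^ (1 / p) := by
  have h1 : ∫⁻ x, E.indicator (fun x => (y : ℝ≥0∞) * v x ^ (1 / r)) x ^ p * u x ^ (p / p₀) =
      (y : ℝ≥0∞) ^ p * volume.withDensity (fun x => u x ^ (p / p₀) * v x ^ (p / r)) E := by
    have hm : AEMeasurable (fun x => u x ^ (p / p₀) * v x ^ (p / r)) volume :=
      (hu.pow_const _).mul (hv.pow_const _)
    rw [withDensity_apply', ← lintegral_const_mul'' _ hm.restrict, ← lintegral_indicator₀ hE]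
    refine lintegral_congr fun x => ?_
    by_cases hx : x ∈ E
    · simp only [Set.indicator_of_mem hx]
      rw [ENNReal.mul_rpow_of_nonneg _ _ hp.le, ← ENNReal.rpow_mul, one_div_mul_eq_div]
      ring
    · simp [hx, hp]
  rw [h1, ENNReal.mul_rpow_of_nonneg _ _ (by positivity), ← ENNReal.rpow_mul,
    mul_one_div_cancel hp.ne', ENNReal.rpow_one]

/-- Extrapolation in the first variable. -/
lemma UniformlyWeakBounded.extrapolate_left
    {T : ((Fin n → ℝ) → 𝕜) → ((Fin n → ℝ) → 𝕜) → ((Fin n → ℝ) → 𝕜)} {p₀ r p q₀ q : ℝ}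
    (hT : UniformlyWeakBounded T p₀ r p) (hp₀ : 1 ≤ p₀) (hr : 0 < r) (hq₀ : 1 < q₀)
    (hp : 1 / p = 1 / p₀ + 1 / r) (hq : 1 / q = 1 / q₀ + 1 / r) :
    UniformlyWeakBounded T q₀ r q := by
  have hp₀0 : 0 < p₀ := by linarith
  have hq₀0 : 0 < q₀ := by linarith
  have hp0 : 0 < p := by
    have : 0 < 1 / p := by rw [hp]; positivity
    exact one_div_pos.1 this
  have hq0 : 0 < q := by
    have : 0 < 1 / q := by rw [hq]; positivity
    exact one_div_pos.1 this
  intro M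
  obtain ⟨A, D, hAD⟩ := extrapolatesTo n hp₀ hq₀ hq0 hp0 (by linarith) M
  obtain ⟨C, hC⟩ := hT (max A M)
  refine ⟨D * C, fun w₁ w₂ hw₁ hw₂ h₁ h₂ f₁ f₂ hf₁ hf₂ => ?_⟩
  have hw₁m := hw₁.1.aemeasurable
  have hw₂m := hw₂.1.aemeasurable
  have hf₁m : AEStronglyMeasurable f₁ volume := hf₁.1.mono_ac
    (withDensity_absolutelyContinuous' hw₁m (isWeight_ne_zero hw₁.1))
  have hf₁I : ∫⁻ x, ‖f₁ x‖ₑ ^ q₀ * w₁ x ≠ ∞ := by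
    intro h
    have := hf₁.2
    rw [eLpNorm_withDensity hq₀0 hw₁m hf₁m, h, ENNReal.top_rpow_of_pos (by positivity)] at this
    exact lt_irrefl _ this
  obtain ⟨⟨u₀, hu₀, hu₀A, hu₀f⟩, hext⟩ := hAD w₁ hw₁ h₁ (fun x => ‖f₁ x‖ₑ) hf₁m.enorm hf₁I
  have hbdd : ∀ u : (Fin n → ℝ) → ℝ≥0∞, MemAp p₀ u → apConst p₀ u ≤ A →
      ∫⁻ x, ‖f₁ x‖ₑ ^ p₀ * u x ≠ ∞ → _ := fun u hu huA huf =>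
    hC u w₂ hu hw₂ (huA.trans (by exact_mod_cast le_max_left A M))
      (h₂.trans (by exact_mod_cast le_max_right A M)) f₁ f₂
      (memLp_withDensity hp₀0 hu.1.aemeasurable hf₁m huf) hf₂
  -- Measurability is needed before `H` can be formed. One admissible weight `u₀` provides it, and
  -- positivity of the weights transfers it to Lebesgue measure.
  have hTm : AEStronglyMeasurable (T f₁ f₂) volume := by
    refine (hbdd u₀ hu₀ hu₀A hu₀f).1.mono_ac (withDensity_absolutelyContinuous'
      ((hu₀.1.aemeasurable.pow_const _).mul (hw₂m.pow_const _)) ?_)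
    filter_upwards [isWeight_ne_zero hu₀.1, isWeight_ne_top hu₀.1, isWeight_ne_zero hw₂.1,
      isWeight_ne_top hw₂.1] with x h1 h2 h3 h4
    exact mul_ne_zero (ENNReal.rpow_pos (pos_iff_ne_zero.2 h1) h2).ne'
      (ENNReal.rpow_pos (pos_iff_ne_zero.2 h3) h4).ne'
  refine ⟨hTm.mono_ac (withDensity_absolutelyContinuous _ _), iSup_le fun y => ?_⟩
  have hE : NullMeasurableSet {x | (y : ℝ) < ‖T f₁ f₂ x‖} volume :=
    nullMeasurableSet_lt aemeasurable_const hTm.norm.aemeasurable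
  rw [← lintegral_indicator_rpow_mul_rpow hq0 y hE hw₁m hw₂m, eLpNorm_withDensity hq₀0 hw₁m hf₁m]
  -- Here `H` is `y · 1_E · w₂^{1/r}`, independent of `u`, and the norm of `f₂` is absorbed into the
  -- constant.
  refine (hext _ (C * eLpNorm f₂ (ENNReal.ofReal r) (volume.withDensity w₂))
    (((hw₂m.pow_const _).const_mul _).indicator₀ hE) ?_ fun u hu huA huf => ?_).trans
      (le_of_eq ?_)
  · filter_upwards [isWeight_ne_zero hw₂.1, isWeight_ne_top hw₂.1] with x h3 h4
    by_cases hx : x ∈ {x | (y : ℝ) < ‖T f₁ f₂ x‖}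
    · rw [Set.indicator_of_mem hx]
      exact ENNReal.mul_ne_top ENNReal.coe_ne_top (ENNReal.rpow_ne_top_of_ne_zero h3 h4)
    · rw [Set.indicator_of_notMem hx]
      exact ENNReal.zero_ne_top
  · rw [lintegral_indicator_rpow_mul_rpow hp0 y hE hu.1.aemeasurable hw₂m]
    refine le_trans (le_iSup (fun y : ℝ≥0 => (y : ℝ≥0∞) * volume.withDensity
      (fun x => u x ^ (p / p₀) * w₂ x ^ (p / r)) {x | (y : ℝ) < ‖T f₁ f₂ x‖} ^ (1 / p)) y) ?_
    refine (hbdd u hu huA huf).2.trans (le_of_eq ?_)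
    rw [eLpNorm_withDensity hp₀0 hu.1.aemeasurable hf₁m]
    ring
  · rw [ENNReal.coe_mul]
    ring

lemma uniformlyWeakBounded_of_locallyBdd
    {T : ((Fin n → ℝ) → 𝕜) → ((Fin n → ℝ) → 𝕜) → ((Fin n → ℝ) → 𝕜)} {p₁ p₂ p : ℝ}
    (hp₁ : 1 ≤ p₁) (hp₂ : 1 ≤ p₂) {φ : ℝ≥0 → ℝ≥0 → ℝ≥0} (hφ : LocallyBdd φ)
    (hT : ∀ w₁ w₂ : (Fin n → ℝ) → ℝ≥0∞, MemAp p₁ w₁ → MemAp p₂ w₂ →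
      WeakBoundedWith T p₁ p₂ p w₁ w₂ (fun x => w₁ x ^ (p / p₁) * w₂ x ^ (p / p₂))
        (φ (apConst p₁ w₁).toNNReal (apConst p₂ w₂).toNNReal)) :
    UniformlyWeakBounded T p₁ p₂ p := by
  intro M
  obtain ⟨C, hC⟩ := hφ (M + 1)
  refine ⟨C, fun w₁ w₂ hw₁ hw₂ h₁ h₂ f₁ f₂ hf₁ hf₂ => ?_⟩
  obtain ⟨h1, h2⟩ := hT w₁ w₂ hw₁ hw₂ f₁ f₂ hf₁ hf₂
  have hlt : ∀ a : ℝ≥0∞, a ≤ M → a.toNNReal < M + 1 := fun a ha =>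
    (ENNReal.toNNReal_mono ENNReal.coe_ne_top ha).trans_lt (lt_add_one M)
  have hle := hC _ _ (ENNReal.toNNReal_pos (apConst_pos hp₁ hw₁.1).ne' hw₁.2.ne) (hlt _ h₁)
    (ENNReal.toNNReal_pos (apConst_pos hp₂ hw₂.1).ne' hw₂.2.ne) (hlt _ h₂)
  exact ⟨h1, h2.trans (by gcongr)⟩

lemma UniformlyWeakBounded.exists_locallyBdd
    {T : ((Fin n → ℝ) → 𝕜) → ((Fin n → ℝ) → 𝕜) → ((Fin n → ℝ) → 𝕜)} {p₁ p₂ p : ℝ}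
    (hT : UniformlyWeakBounded T p₁ p₂ p) :
    ∃ ψ : ℝ≥0 → ℝ≥0 → ℝ≥0, LocallyBdd ψ ∧
      ∀ w₁ w₂ : (Fin n → ℝ) → ℝ≥0∞, MemAp p₁ w₁ → MemAp p₂ w₂ →
        WeakBoundedWith T p₁ p₂ p w₁ w₂ (fun x => w₁ x ^ (p / p₁) * w₂ x ^ (p / p₂))
          (ψ (apConst p₁ w₁).toNNReal (apConst p₂ w₂).toNNReal) := by
  choose C hC using hT
  -- The chosen `C` need be neither monotone nor bounded on bounded sets. Rounding its argument up
  -- to an integer leaves finitely many values for `s, t < M`, and their sum bounds them all.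
  refine ⟨fun s t => C (⌈max s t⌉₊ : ℕ), fun M => ?_, fun w₁ w₂ hw₁ hw₂ => ?_⟩
  · refine ⟨∑ k ∈ Finset.range (⌈M⌉₊ + 1), C (k : ℕ), fun s t _ hs _ ht => ?_⟩
    refine Finset.single_le_sum (f := fun k : ℕ => C (k : ℝ≥0)) (fun _ _ => zero_le) ?_
    rw [Finset.mem_range, Nat.lt_succ_iff]
    exact Nat.ceil_mono (max_lt hs ht).le
  · have hle : max (apConst p₁ w₁).toNNReal (apConst p₂ w₂).toNNReal ≤
        (⌈max (apConst p₁ w₁).toNNReal (apConst p₂ w₂).toNNReal⌉₊ : ℕ) := Nat.le_ceil _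
    refine hC _ w₁ w₂ hw₁ hw₂ ?_ ?_
    · rw [← ENNReal.coe_toNNReal hw₁.2.ne, ENNReal.coe_le_coe]
      exact (le_max_left _ _).trans hle
    · rw [← ENNReal.coe_toNNReal hw₂.2.ne, ENNReal.coe_le_coe]
      exact (le_max_right _ _).trans hle

end Bilinear

theorem theorem3p11 {n : ℕ} (hn : 0 < n) {𝕜 : Type*} [RCLike 𝕜]
    (T : ((Fin n → ℝ) → 𝕜) → ((Fin n → ℝ) → 𝕜) → ((Fin n → ℝ) → 𝕜))
    (p₁ p₂ p : ℝ) (hp₁ : 1 ≤ p₁) (hp₂ : 1 ≤ p₂) (hp : 1 / p = 1 / p₁ + 1 / p₂)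
    (φ : ℝ≥0 → ℝ≥0 → ℝ≥0) (hφ : LocallyBdd φ)
    (hT : ∀ w₁ w₂ : (Fin n → ℝ) → ℝ≥0∞, MemAp p₁ w₁ → MemAp p₂ w₂ →
      WeakBoundedWith T p₁ p₂ p w₁ w₂ (fun x => w₁ x ^ (p / p₁) * w₂ x ^ (p / p₂))
        (φ (apConst p₁ w₁).toNNReal (apConst p₂ w₂).toNNReal))
    (q₁ q₂ q : ℝ) (hq₁ : 1 < q₁) (hq₂ : 1 < q₂) (hq : 1 / q = 1 / q₁ + 1 / q₂) :
    ∃ ψ : ℝ≥0 → ℝ≥0 → ℝ≥0, LocallyBdd ψ ∧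
      ∀ w₁ w₂ : (Fin n → ℝ) → ℝ≥0∞, MemAp q₁ w₁ → MemAp q₂ w₂ →
        WeakBoundedWith T q₁ q₂ q w₁ w₂ (fun x => w₁ x ^ (q / q₁) * w₂ x ^ (q / q₂))
          (ψ (apConst q₁ w₁).toNNReal (apConst q₂ w₂).toNNReal) := by
  have h0 := uniformlyWeakBounded_of_locallyBdd hp₁ hp₂ hφ hT
  have hq₁0 : 0 < q₁ := by linarith
  have hp₂0 : 0 < p₂ := by linarith
  have hs : 0 < 1 / q₁ + 1 / p₂ := by positivity
  -- Only `p₁` has moved, so the intermediate target exponent is the one belonging to the pair `q₁,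
  -- p₂`.
  have h1 : UniformlyWeakBounded T q₁ p₂ (1 / (1 / q₁ + 1 / p₂)) :=
    h0.extrapolate_left hp₁ hp₂0 hq₁ hp (one_div_one_div _)
  have h2 : UniformlyWeakBounded (fun f g => T g f) q₂ q₁ q :=
    h1.swap.extrapolate_left hp₂ hq₁0 hq₂ (by rw [one_div_one_div, add_comm])
      (by rw [hq, add_comm])
  exact h2.swap.exists_locallyBdd
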